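/- Let $k$ be a field of characteristic zero and $A=\bigoplus_{n\in\mathbb Z}A^n$ a graded $k$-vector space; $|a|$ is the degree of a homogeneous $a$, and $\|a\|=|a|-1$. **Partitions.** An ordered partition is $\pi=(i_1|\cdots|i_r)$ with $r\ge 1$ and integers $i_l\ge 0$ (slots of $i_l$ arguments); $d(\pi)=i_1+\cdots+i_r-1$ and $\bar d(\pi)=r-1$. We write $\tau\to\pi*\rho$, for $\rho=(j_1|\cdots|j_s)$, if $\tau$ arises from $\pi$ by replacing one slot $i_l\geq 1$ by $(j_1+u_1|\cdots|j_s+u_s)$ with $u_q\ge 0$, $u_1+\cdots+u_s=i_l-1$. **Composition.** A partitioned map $x(\pi)$ is a multilinear map $A^{\otimes i_1}\otimes\cdots\otimes A^{\otimes i_r}\to A$ labelled by $\pi$. If it changes the total degree of its arguments by $|x|\in\mathbb Z$, put $\|x(\pi)\|=d(\pi)+\bar d(\pi)+|x|$. For $\tau=(k_1|\cdots|k_t)\to\pi*\rho$ the component of type $\tau$ of $\{x(\pi)\}\{y(\rho)\}$ takes homogeneous arguments $a^{(1)}|\cdots|a^{(t)}$ (words of lengths $k_1,\dots,k_t$) to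 the following sum. Sum over all slots $l$ of $\pi$ through which $\tau$ arises, and over all subdivisions $a^{(l+q-1)}=b^{(q)}c^{(q)}d^{(q)}$, $1\le q\le s$, with $c^{(q)}$ of length $j_q$ and with total length of all $b^{(q)},d^{(q)}$ equal to $i_l-1$, and over all shuffles $B$ of the words $b^{(q)}$ and $D$ of the words $d^{(q)}$, the terms $$\pm\,x\big(a^{(1)}|\cdots|a^{(l-1)}|B,\;y(c^{(1)}|\cdots|c^{(s)}),\;D\,|a^{(l+s)}|\cdots|a^{(t)}\big).$$ The sign is the product of $(-1)^{\|u\|\|v\|}$ over all pairs of symbols $u,v$ interchanged in passing from the word $y\,a^{(1)}|\cdots|a^{(t)}$ to the word $a^{(1)}|\cdots|B\,y\,c^{(1)}|\cdots|c^{(s)}D|\cdots|a^{(t)}$, each bar being a symbol of degree $1$. For a map $x$ with $n$ arguments let $$\tilde x(a_1,\dots,a_n)=(-1)^{(n-1)\|a_1\|+(n-2)\|a_2\|+\cdots+\|a_{n-1}\|}x(a_1,\dots,a_n).$$ For a formal sum $m=\sum_\pi m(\pi)$ of homogeneous partitioned maps over all ordered partitions, $\{\tilde m\}\{\tilde m\}=0$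 means that for every ordered partition $\tau$ the finite sum, over all $(\pi,\rho)$ with $\tau\to\pi*\rho$, of the components of type $\tau$ of $\{\tilde m(\pi)\}\{\tilde m(\rho)\}$ is zero. **Lemma.** Let $m=\sum_\pi m(\pi)$ be a homotopy Gerstenhaber structure on $A$, that is, $|m(\pi)|\equiv d(\pi)+\bar d(\pi)+1\pmod 2$ for all $\pi$ and $\{\tilde m\}\{\tilde m\}=0$, where instead of any other condition on the $m(\pi)$ for partitions with zero slots it is assumed that $m(\pi)=0$ whenever $\pi$ has at least one slot equal to $0$. Let $m_B=m(1)+m(1|1)+m(1|1|1)+\cdots$. Then: 1. $\{\tilde m_B\}\{\tilde m_B\}=0$. 2. $m_B$, with $n$-ary operation $m_n=m(1|\cdots|1)$ ($n$ slots, $n\ge1$), is an $A_\infty$ structure on $A[1]$, where $A[1]^n=A^{n+1}$: in the grading of $A[1]$ the degree of $m_n$ is congruent to $n$ modulo $2$, and for all $n\ge 1$ $$\sum_{r+s+t=n,\ s\ge1}(-1)^{r+st}\,m_{r+1+t}\,(1^{\otimes r}\otimes m_s\otimes 1^{\otimes t})=0,$$ with the Koszul sign $(-1)^{s(\|a_1\|+\cdots+\|a_r\|)}$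 upon evaluation. 3. The graded antisymmetrizations $l_n(a_1,\dots,a_n)=\sum_{\sigma\in S_n}\chi(\sigma;a)\,m_n(a_{\sigma(1)},\dots,a_{\sigma(n)})$, where $\chi(\sigma;a)$ is the signature of $\sigma$ times the Koszul sign with respect to the degrees $\|a_i\|$ in $A[1]$, form an $L_\infty$ structure $l_B$ on $A[1]$: the degree of $l_n$ is congruent to $n$ modulo $2$, $l_n$ is graded antisymmetric, and for all $n\ge1$ $$\sum_{i+j=n+1}\ \sum_{\sigma}\chi(\sigma;a)(-1)^{i(j-1)}\,l_j\big(l_i(a_{\sigma(1)},\dots,a_{\sigma(i)}),a_{\sigma(i+1)},\dots,a_{\sigma(n)}\big)=0,$$ where $i,j\ge 1$ and $\sigma$ runs over the $(i,n-i)$-unshuffles. -/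

import Mathlib

namespace HomotopyGerstenhaber

/-! ### Ordered partitions and their product -/

/-- Ordered partitions `(i₁|⋯|iᵣ)`, with `r ≥ 1` slots and entries `iₗ ≥ 0`. -/
abbrev OrdPartition : Type := {π : List ℕ // π ≠ []}

namespace OrdPartition

/-- The total number `i₁ + ⋯ + iᵣ` of arguments. -/
abbrev args (π : OrdPartition) : ℕ := π.1.sum

/-- `d(π)`: the number of arguments minus one. -/
def d (π : OrdPartition) : ℤ := (π.1.sum : ℤ) - 1

/-- `d̄(π)`: the number of slots minus one. -/
def dBar (π : OrdPartition) : ℤ := (π.1.length : ℤ) - 1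

/-- `π` has at least one slot without arguments. -/
def HasZeroSlot (π : OrdPartition) : Prop := 0 ∈ π.1

/-- The basis elements that occur in the product `π ∗ ρ`: one slot `i` of `π` is replaced by
`(j₁ + u₁|⋯|jₛ + uₛ)`, where `ρ = (j₁|⋯|jₛ)`, `uₗ ≥ 0` and `u₁ + ⋯ + uₛ = i - 1`. Each basis
element counts once. -/
def star (π ρ : OrdPartition) : Set OrdPartition :=
  {τ | ∃ (pre post u : List ℕ) (i : ℕ), π.1 = pre ++ i :: post ∧
    u.length = ρ.1.length ∧ u.sum + 1 = i ∧ τ.1 = pre ++ List.zipWith (· + ·) ρ.1 u ++ post}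

theorem finite_lists (N : ℕ) : {l : List ℕ | l.length ≤ N ∧ ∀ x ∈ l, x ≤ N}.Finite := by
  refine ((List.finite_length_le (Fin (N + 1)) N).image (List.map Fin.val)).subset ?_
  rintro l ⟨hl, hx⟩
  refine ⟨l.map (Fin.ofNat (N + 1)), by simpa using hl, ?_⟩
  rw [List.map_map]
  conv_rhs => rw [← List.map_id l]
  refine List.map_congr_left fun x h => ?_
  simpa using Nat.lt_succ_of_le (hx x h)

theorem sum_zipWith_add : ∀ (v u : List ℕ), u.length = v.length →
    (List.zipWith (· + ·) v u).sum = v.sum + u.sum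
  | [], [], _ => by simp
  | a :: v, b :: u, h => by
    have := sum_zipWith_add v u (by simpa using h)
    simp only [List.zipWith_cons_cons, List.sum_cons, this]
    omega

/-- Only finitely many products `π ∗ ρ` contain a given `τ`. -/
theorem finite_star (τ : OrdPartition) :
    {P : OrdPartition × OrdPartition | τ ∈ star P.1 P.2}.Finite := by
  have hfin := ((finite_lists (τ.1.length + τ.1.sum + 1)).preimage
    (Subtype.val_injective (p := fun π : List ℕ => π ≠ [])).injOn)
  refine (hfin.prod hfin).subset ?_
  rintro ⟨⟨π, hπ⟩, ⟨ρ, hρ⟩⟩ ⟨pre, post, u, i, h1, h2, h3, h4⟩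
  have hs := congrArg List.sum h4
  have hl := congrArg List.length h4
  have hρl : 0 < ρ.length := List.length_pos_iff.mpr hρ
  simp only at h1 h2 hs hl
  simp only [List.sum_append, sum_zipWith_add _ _ h2] at hs
  simp only [List.length_append, List.length_zipWith, h2, min_self] at hl
  have hπs : π.sum = pre.sum + i + post.sum := by subst h1; simp; omega
  have hπl : π.length = pre.length + post.length + 1 := by subst h1; simp; omega
  refine ⟨⟨by simp only; omega, fun x hx => ?_⟩, ⟨by simp only; omega, fun x hx => ?_⟩⟩
  · have : x ≤ π.sum := List.le_sum_of_mem hx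
    omega
  · have : x ≤ ρ.sum := List.le_sum_of_mem hx
    omega

/-- The finite set of pairs `(π, ρ)` such that `τ` occurs in `π ∗ ρ`. -/
noncomputable def factorPairs (τ : OrdPartition) : Finset (OrdPartition × OrdPartition) :=
  (finite_star τ).toFinset

theorem mem_factorPairs {τ π ρ : OrdPartition} : (π, ρ) ∈ factorPairs τ ↔ τ ∈ star π ρ := by
  simp [factorPairs]

/-- The argument numbers of a map of type `π`, distributed over the slots:
`(a^{(1)}|⋯|a^{(r)})` with `a^{(l)}` of length `iₗ`, in lexicographical order. -/
def slots (π : OrdPartition) : List (List (Fin π.args)) :=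
  π.1.splitLengths (List.finRange π.args)

end OrdPartition

/-! ### Koszul signs -/

/-- The symbols in `{x}{y}{a^{(1)}|⋯|a^{(t)}}` that may be interchanged: the inserted map `y`,
the arguments, and the bars (`bar q` stands behind the slot number `q`). -/
inductive Symb (ι : Type) where
  | op : Symb ι
  | arg (i : ι) : Symb ι
  | bar (q : ℕ) : Symb ι
  deriving DecidableEq

/-- The word `a^{(1)}|a^{(2)}|⋯|a^{(s)}`; the first bar has number `q`. -/
def slotWord {ι : Type} : ℕ → List (List ι) → List (Symb ι)
  | _, [] => []
  | _, [v] => v.map Symb.arg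
  | q, v :: w :: vs => v.map Symb.arg ++ Symb.bar q :: slotWord (q + 1) (w :: vs)

/-- The word `a^{(1)}|⋯|a^{(l)}|`, with a bar behind every slot; the first bar has number `0`. -/
def wordBefore {ι : Type} (vs : List (List ι)) : List (Symb ι) :=
  (vs.zipIdx).flatMap fun v => v.1.map Symb.arg ++ [Symb.bar v.2]

/-- The word `|a^{(1)}|⋯|a^{(l)}`, with a bar before every slot; the first bar has number `q`. -/
def wordAfter {ι : Type} (q : ℕ) (vs : List (List ι)) : List (Symb ι) :=
  (vs.zipIdx q).flatMap fun v => Symb.bar v.2 :: v.1.map Symb.arg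

/-- Total degrees `‖·‖`: that of the inserted map is `q`, an argument `a` has
`‖a‖ = |a| + d(a) = |a| - 1`, and a bar carries one unit of the degree `d̄`. -/
def Symb.degree {ι : Type} (q : ℤ) (p : ι → ℤ) : Symb ι → ℤ
  | op => q
  | arg i => p i - 1
  | bar _ => 1

/-- The sign of the rearrangement of the word `old` into the word `new`: the product of
`(-1)^{‖u‖‖v‖}` over the pairs `u, v` that are interchanged. -/
def koszulSign {S : Type} [DecidableEq S] (deg : S → ℤ) (old : List S) : List S → ℤˣ
  | [] => 1
  | u :: new => ((new.filter fun v => old.idxOf v < old.idxOf u).map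
      fun v => (deg u * deg v).negOnePow).prod * koszulSign deg old new

/-! ### Subdivisions and shuffles -/

/-- All `(b, c, d)` with `v = b ++ c ++ d` and `c` of length `j`. -/
def splits {α : Type*} (j : ℕ) (v : List α) : List (List α × List α × List α) :=
  (List.range (v.length + 1 - j)).map fun n => (v.take n, (v.drop n).take j, v.drop (n + j))

/-- All simultaneous subdivisions `a^{(l)} = b^{(l)} c^{(l)} d^{(l)}` with `c^{(l)}` of
length `jₗ`. -/
def subdivisions {α : Type*} :
    List ℕ → List (List α) → List (List (List α × List α × List α))
  | [], [] => [[]]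
  | j :: js, v :: vs => (splits j v).flatMap fun s => (subdivisions js vs).map (s :: ·)
  | [], _ :: _ => []
  | _ :: _, [] => []

/-- All shuffles of two words. -/
def shuffle {α : Type*} : List α → List α → List (List α)
  | [], w => [w]
  | x :: v, [] => [x :: v]
  | x :: v, y :: w =>
    (shuffle v (y :: w)).map (x :: ·) ++ (shuffle (x :: v) w).map (y :: ·)

/-- All shuffles of several words: the terms of `{b^{(1)}}⋯{b^{(s)}}`. -/
def shuffles {α : Type*} : List (List α) → List (List α)
  | [] => [[]]
  | v :: vs => (shuffles vs).flatMap (shuffle v)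

section Maps

variable {k : Type*} [Field k] {A : Type*} [AddCommGroup A] [Module k A]

/-- The value of an `n`-linear map at a word of length `n`. -/
def evalOn {n : ℕ} (x : MultilinearMap k (fun _ : Fin n => A) A) (w : List A) : A :=
  x fun i => w.getD i 0

/-- `x` changes the total super degree of its arguments by `s`. -/
def IsHomogeneousOfDegree (𝒜 : ℤ → Submodule k A) {n : ℕ}
    (x : MultilinearMap k (fun _ : Fin n => A) A) (s : ℤ) : Prop :=
  ∀ (p : Fin n → ℤ) (a : Fin n → A), (∀ i, a i ∈ 𝒜 (p i)) → x a ∈ 𝒜 (∑ i, p i + s)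

/-! ### Composition of partitioned maps -/

/-- The component of type `τ` of `{x(π)}{y(ρ)}`, at homogeneous arguments `a i` of super degrees
`p i`; here `q = ‖y‖`. For each slot number `l` of `π` which can produce `τ`, the `s` slots
of `τ` from number `l` on are subdivided as `b^{(·)} c^{(·)} d^{(·)}`, and
`x(⋯ | B, y(c^{(1)}|⋯|c^{(s)}), D | ⋯)` is summed over the shuffles `B` of the `b^{(·)}` and `D`
of the `d^{(·)}`, with the sign of the rearrangement of `y a^{(1)}|⋯|a^{(t)}`. -/
def comp {π ρ : OrdPartition} (x : MultilinearMap k (fun _ : Fin π.args => A) A)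
    (y : MultilinearMap k (fun _ : Fin ρ.args => A) A) (q : ℤ) (τ : OrdPartition)
    (p : Fin τ.args → ℤ) (a : Fin τ.args → A) : A :=
  ∑ l ∈ Finset.range π.1.length,
    let pre := τ.slots.take l
    let mid := (τ.slots.drop l).take ρ.1.length
    let post := τ.slots.drop (l + ρ.1.length)
    if pre.map List.length = π.1.take l ∧ post.map List.length = π.1.drop (l + 1) then
      ((subdivisions ρ.1 mid).map fun S =>
        let b := S.map fun v => v.1
        let c := S.map fun v => v.2.1
        let d := S.map fun v => v.2.2
        if b.flatten.length + 1 + d.flatten.length = π.1.getD l 0 then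
          ((shuffles b).map fun B => ((shuffles d).map fun D =>
            koszulSign (Symb.degree q p) (Symb.op :: slotWord 0 τ.slots)
              (wordBefore pre ++ B.map Symb.arg ++ Symb.op :: slotWord l c ++ D.map Symb.arg ++
                wordAfter (l + ρ.1.length - 1) post) •
            evalOn x (pre.flatten.map a ++ B.map a ++ evalOn y (c.flatten.map a) :: D.map a ++
              post.flatten.map a)).sum).sum
        else 0).sum
    else 0

/-- A formal sum `m = ∑ m(π)` of partitioned multilinear maps, one of each type, with `m(π)`
homogeneous of super degree `|m(π)|`. -/
structure PartitionedSum (𝒜 : ℤ → Submodule k A) where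
  /-- the map `m(π)` -/
  map : ∀ π : OrdPartition, MultilinearMap k (fun _ : Fin π.args => A) A
  /-- its super degree `|m(π)|` -/
  superDegree : OrdPartition → ℤ
  isHomogeneous : ∀ π, IsHomogeneousOfDegree 𝒜 (map π) (superDegree π)

/-- The total degree `‖m(π)‖ = d(π) + d̄(π) + |m(π)|`. -/
def PartitionedSum.totalDegree {𝒜 : ℤ → Submodule k A} (m : PartitionedSum 𝒜)
    (π : OrdPartition) : ℤ :=
  π.d + π.dBar + m.superDegree π

/-- The linear map `a ↦ (-1)^{‖a‖} a`, where `‖a‖ = |a| - 1`. -/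
noncomputable def signMap (𝒜 : ℤ → Submodule k A) [DirectSum.Decomposition 𝒜] : A →ₗ[k] A :=
  (DirectSum.toModule k ℤ A fun n => ((n - 1).negOnePow : ℤ) • (𝒜 n).subtype) ∘ₗ
    (DirectSum.decomposeLinearEquiv 𝒜).toLinearMap

theorem signMap_of_mem (𝒜 : ℤ → Submodule k A) [DirectSum.Decomposition 𝒜] {n : ℤ} {a : A}
    (ha : a ∈ 𝒜 n) : signMap 𝒜 a = (n - 1).negOnePow • a := by
  have := DirectSum.decomposeLinearEquiv_apply_coe (R := k) 𝒜 n ⟨a, ha⟩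
  simp only at this
  simp [signMap, this, DirectSum.toModule_lof, Units.smul_def]

/-- `x̃(a₁,…,aₙ) = (-1)^{(n-1)‖a₁‖ + (n-2)‖a₂‖ + ⋯ + ‖aₙ₋₁‖} x(a₁,…,aₙ)`. -/
noncomputable def tilde (𝒜 : ℤ → Submodule k A) [DirectSum.Decomposition 𝒜] {n : ℕ}
    (x : MultilinearMap k (fun _ : Fin n => A) A) : MultilinearMap k (fun _ : Fin n => A) A :=
  x.compLinearMap fun i => signMap 𝒜 ^ (n - 1 - (i : ℕ))

/-- `{m̃}{m̃} = 0`: for every ordered partition `τ`, the sum of the maps of type `τ` that result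
from the compositions of all `m(π)` and `m(ρ)` such that `τ` occurs in `π ∗ ρ` is zero. -/
def MasterIdentity {𝒜 : ℤ → Submodule k A} [DirectSum.Decomposition 𝒜]
    (m : PartitionedSum 𝒜) : Prop :=
  ∀ (τ : OrdPartition) (p : Fin τ.args → ℤ) (a : Fin τ.args → A), (∀ i, a i ∈ 𝒜 (p i)) →
    ∑ P ∈ τ.factorPairs,
      comp (tilde 𝒜 (m.map P.1)) (tilde 𝒜 (m.map P.2)) (m.totalDegree P.2) τ p a = 0

/-- A homotopy Gerstenhaber structure, where nothing is prescribed about the maps `m(π)` for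
partitions `π` with zero slots. -/
structure IsGInfinity {𝒜 : ℤ → Submodule k A} [DirectSum.Decomposition 𝒜]
    (m : PartitionedSum 𝒜) : Prop where
  superDegree_modEq : ∀ π, m.superDegree π ≡ π.d + π.dBar + 1 [ZMOD 2]
  master : MasterIdentity m

/-- `m_B = m(1) + m(1|1) + m(1|1|1) + ⋯`, as a formal sum of partitioned maps. -/
noncomputable def PartitionedSum.partB {𝒜 : ℤ → Submodule k A} (m : PartitionedSum 𝒜) :
    PartitionedSum 𝒜 where
  map π := open Classical in if ∀ i ∈ π.1, i = 1 then m.map π else 0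
  superDegree := m.superDegree
  isHomogeneous π p a ha := by
    split_ifs
    · exact m.isHomogeneous π p a ha
    · exact zero_mem _

/-- The partition `(1|1|⋯|1)` with `n + 1` slots. -/
def ones (n : ℕ) : OrdPartition := ⟨List.replicate (n + 1) 1, by simp⟩

theorem args_ones (n : ℕ) : (ones n).args = n + 1 := by simp [OrdPartition.args, ones]

/-- The `n`-linear term of `m_B`, as an ordinary multilinear map: it is `m(1|⋯|1)` for `n ≥ 1`,
and there is no term for `n = 0`. -/
def PartitionedSum.opsB {𝒜 : ℤ → Submodule k A} (m : PartitionedSum 𝒜) :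
    ∀ n : ℕ, MultilinearMap k (fun _ : Fin n => A) A
  | 0 => 0
  | n + 1 => (m.map (ones n)).domDomCongr (finCongr (args_ones n))

/-! ### `A∞` and `L∞` algebras -/

/-- The grading of `A[1]`, that is `A[1]ⁿ = Aⁿ⁺¹`. -/
def shift (𝒜 : ℤ → Submodule k A) : ℤ → Submodule k A := fun n => 𝒜 (n + 1)

theorem le_shift (𝒜 : ℤ → Submodule k A) (n : ℤ) : 𝒜 n ≤ shift 𝒜 (n - 1) := by
  simp [shift]

theorem lof_shift (𝒜 : ℤ → Submodule k A) {n j : ℤ} (h : n = j) (v : A) (hn : v ∈ shift 𝒜 n)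
    (hj : v ∈ shift 𝒜 j) :
    DirectSum.lof k ℤ (fun i => shift 𝒜 i) n ⟨v, hn⟩ =
      DirectSum.lof k ℤ (fun i => shift 𝒜 i) j ⟨v, hj⟩ := by
  subst h; rfl

noncomputable instance shiftDecomposition (𝒜 : ℤ → Submodule k A) [DirectSum.Decomposition 𝒜] :
    DirectSum.Decomposition (shift 𝒜) :=
  DirectSum.Decomposition.ofLinearMap (shift 𝒜)
    ((DirectSum.toModule k ℤ (DirectSum ℤ fun n => shift 𝒜 n) fun n =>
      DirectSum.lof k ℤ (fun n => shift 𝒜 n) (n - 1) ∘ₗ Submodule.inclusion (le_shift 𝒜 n)) ∘ₗ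
        (DirectSum.decomposeLinearEquiv 𝒜).toLinearMap)
    (by
      refine DirectSum.decompose_lhom_ext 𝒜 fun n => LinearMap.ext fun v => ?_
      simp [DirectSum.toModule_lof])
    (by
      refine DirectSum.linearMap_ext k fun n => LinearMap.ext fun v => ?_
      have h := DirectSum.decomposeLinearEquiv_apply_coe (R := k) 𝒜 (n + 1) v
      simp only [LinearMap.comp_apply, LinearEquiv.coe_coe, DirectSum.coeLinearMap_lof,
        LinearMap.id_apply]
      refine (congrArg _ h).trans ?_
      refine (DirectSum.toModule_lof (M := fun i => 𝒜 i) k (n + 1) (⟨v.1, v.2⟩ : 𝒜 (n + 1))).trans ?_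
      exact lof_shift 𝒜 (by ring) v.1 _ v.2)

/-- The operations `m n : A^{⊗n} → A`, `n ≥ 1`, form an `A∞` structure on the graded vector
space with homogeneous components `𝒜 n`: they have degree `n` modulo 2, and
`∑ (-1)^{r + st} mᵣ₊₁₊ₜ (1^{⊗r} ⊗ mₛ ⊗ 1^{⊗t}) = 0`, the sum being over `r + s + t = n`, for
all `n ≥ 1`; when applied to elements, `mₛ` is moved past the first `r` arguments. -/
structure IsAInfinity (𝒜 : ℤ → Submodule k A)
    (m : ∀ n : ℕ, MultilinearMap k (fun _ : Fin n => A) A) : Prop where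
  degree : ∀ n : ℕ, 1 ≤ n → ∃ s : ℤ, s ≡ (n : ℤ) [ZMOD 2] ∧ IsHomogeneousOfDegree 𝒜 (m n) s
  relation : ∀ n : ℕ, 1 ≤ n → ∀ (p : Fin n → ℤ) (a : Fin n → A), (∀ i, a i ∈ 𝒜 (p i)) →
    ∑ s ∈ Finset.Icc 1 n, ∑ r ∈ Finset.range (n - s + 1),
      ((r : ℤ) + s * (n - s - r : ℕ) + s * ∑ i with i.val < r, p i).negOnePow •
        evalOn (m (n - s + 1))
          ((List.ofFn a).take r ++ evalOn (m s) (((List.ofFn a).drop r).take s) ::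
            (List.ofFn a).drop (r + s)) = 0

/-- The sign `χ(σ; a)` with `a₁ ∧ ⋯ ∧ aₙ = χ(σ; a) a_{σ(1)} ∧ ⋯ ∧ a_{σ(n)}` for elements `aᵢ` of
degrees `p i`: the signature times the Koszul sign. -/
def antisymmSign {n : ℕ} (σ : Equiv.Perm (Fin n)) (p : Fin n → ℤ) : ℤˣ :=
  Equiv.Perm.sign σ *
    ∏ ij : Fin n × Fin n with ij.1 < ij.2 ∧ σ ij.2 < σ ij.1,
      (p (σ ij.1) * p (σ ij.2)).negOnePow

/-- The operations `l n : A^{⊗n} → A`, `n ≥ 1`, form an `L∞` structure on the graded vector space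
with homogeneous components `𝒜 n`: they have degree `n` modulo 2, they are graded antisymmetric,
and for all `n ≥ 1` the sum of
`χ(σ; a) (-1)^{i(j-1)} lⱼ(lᵢ(a_{σ(1)},…,a_{σ(i)}), a_{σ(i+1)},…,a_{σ(n)})` over `i + j = n + 1`
and over the `(i, n - i)`-unshuffles `σ` is zero. -/
structure IsLInfinity (𝒜 : ℤ → Submodule k A)
    (l : ∀ n : ℕ, MultilinearMap k (fun _ : Fin n => A) A) : Prop where
  degree : ∀ n : ℕ, 1 ≤ n → ∃ s : ℤ, s ≡ (n : ℤ) [ZMOD 2] ∧ IsHomogeneousOfDegree 𝒜 (l n) s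
  antisymm : ∀ n : ℕ, 1 ≤ n → ∀ (p : Fin n → ℤ) (a : Fin n → A), (∀ i, a i ∈ 𝒜 (p i)) →
    ∀ σ : Equiv.Perm (Fin n), l n a = antisymmSign σ p • l n fun i => a (σ i)
  relation : ∀ n : ℕ, 1 ≤ n → ∀ (p : Fin n → ℤ) (a : Fin n → A), (∀ i, a i ∈ 𝒜 (p i)) →
    ∑ i ∈ Finset.Icc 1 n,
      ∑ σ : Equiv.Perm (Fin n) with
          (∀ u v, u < v → v.val < i → σ u < σ v) ∧ (∀ u v, i ≤ u.val → u < v → σ u < σ v),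
        (antisymmSign σ p * ((i : ℤ) * (n - i : ℕ)).negOnePow) •
          evalOn (l (n - i + 1))
            (evalOn (l i) ((List.ofFn fun u => a (σ u)).take i) ::
              (List.ofFn fun u => a (σ u)).drop i) = 0

/-- The projection onto the sum of the components of degree `e` modulo 2. -/
noncomputable def parityProj (𝒜 : ℤ → Submodule k A) [DirectSum.Decomposition 𝒜] (e : ZMod 2) :
    A →ₗ[k] A :=
  (DirectSum.toModule k ℤ A fun n => if (n : ZMod 2) = e then (𝒜 n).subtype else 0) ∘ₗ
    (DirectSum.decomposeLinearEquiv 𝒜).toLinearMap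

theorem parityProj_of_mem (𝒜 : ℤ → Submodule k A) [DirectSum.Decomposition 𝒜] {n : ℤ} {a : A}
    (ha : a ∈ 𝒜 n) (e : ZMod 2) : parityProj 𝒜 e a = if (n : ZMod 2) = e then a else 0 := by
  have := DirectSum.decomposeLinearEquiv_apply_coe (R := k) 𝒜 n ⟨a, ha⟩
  simp only at this
  simp only [parityProj, LinearMap.comp_apply, LinearEquiv.coe_coe, this, DirectSum.toModule_lof]
  split_ifs <;> simp

theorem antisymmSign_congr {n : ℕ} (σ : Equiv.Perm (Fin n)) {p p' : Fin n → ℤ}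
    (h : ∀ i, p i ≡ p' i [ZMOD 2]) : antisymmSign σ p = antisymmSign σ p' := by
  unfold antisymmSign
  congr 1
  refine Finset.prod_congr rfl fun ij _ => ?_
  have := Int.ModEq.mul (h (σ ij.1)) (h (σ ij.2))
  rw [Int.negOnePow_eq_iff, ← even_neg, neg_sub]
  exact even_iff_two_dvd.mpr this.dvd

/-- The graded antisymmetrization of `x`: the multilinear map which sends homogeneous
`a₁,…,aₙ` to `∑_σ χ(σ; a) x(a_{σ(1)},…,a_{σ(n)})`. -/
noncomputable def gradedAntisymm (𝒜 : ℤ → Submodule k A) [DirectSum.Decomposition 𝒜] {n : ℕ}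
    (x : MultilinearMap k (fun _ : Fin n => A) A) : MultilinearMap k (fun _ : Fin n => A) A :=
  ∑ σ : Equiv.Perm (Fin n), ∑ e : Fin n → ZMod 2,
    (antisymmSign σ fun i => ((e i).val : ℤ)) •
      (x.domDomCongr σ).compLinearMap fun i => parityProj 𝒜 (e i)

theorem gradedAntisymm_apply_of_mem (𝒜 : ℤ → Submodule k A) [DirectSum.Decomposition 𝒜] {n : ℕ}
    (x : MultilinearMap k (fun _ : Fin n => A) A) (p : Fin n → ℤ) (a : Fin n → A)
    (ha : ∀ i, a i ∈ 𝒜 (p i)) :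
    gradedAntisymm 𝒜 x a =
      ∑ σ : Equiv.Perm (Fin n), antisymmSign σ p • x fun i => a (σ i) := by
  simp only [gradedAntisymm, sum_apply, smul_apply,
    MultilinearMap.compLinearMap_apply, MultilinearMap.domDomCongr_apply]
  refine Finset.sum_congr rfl fun σ _ => ?_
  rw [Finset.sum_eq_single fun i => ((p i : ℤ) : ZMod 2)]
  · congr 1
    · exact antisymmSign_congr σ fun i => by
        exact (ZMod.intCast_eq_intCast_iff _ _ 2).mp (by simp)
    · congr 1
      funext i
      simp [parityProj_of_mem 𝒜 (ha (σ i))]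
  · intro e _ he
    obtain ⟨j, hj⟩ := Function.ne_iff.mp he
    rw [x.map_coord_zero (σ.symm j), smul_zero]
    simp [parityProj_of_mem 𝒜 (ha j), Ne.symm hj]
  · simp

end Maps

end HomotopyGerstenhaber

namespace HomotopyGerstenhaber

/-! The first claim is a statement about partitions. If all slots of `τ` equal 1 and `τ` occurs in
`π ∗ ρ`, each new slot is `j + u = 1`. When `ρ` has no zero slot this forces `j = 1` and `u = 0`, so
the replaced slot is 1 and both factors have only slots 1 (`eq_one_of_ones_mem_star`). Factors `ρ`
with zero slots carry the zero map. Conversely, a product of such partitions is again of this form.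
Hence the master identity of `m_B` agrees with that of `m` at the partitions `(1|⋯|1)` and is
trivial elsewhere.

For the second claim, composition along `(1|⋯|1)` involves no real subdivisions or shuffles: the
inner map moves past `a₁|⋯|aᵣ|`, of degree `|a₁| + ⋯ + |aᵣ|`, because each bar compensates the shift
in `‖a‖ = |a| - 1` (`comp_ones`). The operations and their total degrees are odd. The tilde signs of
the two maps therefore combine with this sign into the tilde sign of the entire word times the sign
of the `A∞` relation (`smul_evalOn_tilde_tilde`). The former is common to all terms and cancels.

The third claim is the usual passage from `A∞` to `L∞`. An unshuffle followed by arbitrary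
rearrangements of its two parts gives every word exactly once. Antisymmetrizing the outer map also
inserts the inner value behind `r` letters of the second part. Moving the inner block to that place
turns the whole sum into the antisymmetrized `A∞` relation (`sum_unshuffles_gradedAntisymm`). Signs
are products over the inversions of words in an ordered alphabet, which makes them compatible with
concatenation and with interchanging blocks (`wordSign_append`, `wordSign_swap_blocks`). The inner
value is treated as an additional smallest letter. -/

theorem negOnePow_congr {a b : ℤ} (h : Even (a - b)) : a.negOnePow = b.negOnePow :=
  (Int.negOnePow_eq_iff a b).mpr h

/-! ### Linearity of evaluation at words -/

section EvalOn

variable {k : Type*} [Field k] {A : Type*} [AddCommGroup A] [Module k A]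

/-- The value of a multilinear map at a word is linear in each letter. -/
theorem exists_linearMap_evalOn {n : ℕ} (x : MultilinearMap k (fun _ : Fin n => A) A)
    (v w : List A) (h : v.length < n) :
    ∃ f : A →ₗ[k] A, ∀ b, evalOn x (v ++ b :: w) = f b := by
  refine ⟨x.toLinearMap (fun i => (v ++ 0 :: w).getD i 0) ⟨v.length, h⟩, fun b => ?_⟩
  rw [MultilinearMap.toLinearMap_apply, evalOn]
  congr 1
  funext i
  by_cases hi : i = ⟨v.length, h⟩
  · subst hi; simp
  · rw [Function.update_of_ne hi]
    have hi' : (i : ℕ) ≠ v.length := fun h' => hi (Fin.ext h')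
    rcases lt_or_gt_of_ne hi' with h' | h'
    · simp [List.getD_eq_getElem?_getD, List.getElem?_append_left h']
    · obtain ⟨j, hj⟩ := Nat.exists_eq_add_of_lt h'
      rw [hj]
      simp [List.getD_eq_getElem?_getD, List.getElem?_append_right, add_assoc]

theorem evalOn_units_smul {n : ℕ} (x : MultilinearMap k (fun _ : Fin n => A) A)
    (v w : List A) (h : v.length < n) (ε : ℤˣ) (b : A) :
    evalOn x (v ++ (ε • b) :: w) = ε • evalOn x (v ++ b :: w) := by
  obtain ⟨f, hf⟩ := exists_linearMap_evalOn x v w h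
  rw [hf, hf, Units.smul_def, Units.smul_def, map_zsmul]

theorem evalOn_sum {n : ℕ} (x : MultilinearMap k (fun _ : Fin n => A) A)
    (v w : List A) (h : v.length < n) {ι : Type*} (s : Finset ι) (b : ι → A) :
    evalOn x (v ++ (∑ i ∈ s, b i) :: w) = ∑ i ∈ s, evalOn x (v ++ b i :: w) := by
  obtain ⟨f, hf⟩ := exists_linearMap_evalOn x v w h
  simp only [hf, map_sum]

theorem evalOn_append_zero {n : ℕ} (x : MultilinearMap k (fun _ : Fin n => A) A)
    (v w : List A) (h : v.length < n) : evalOn x (v ++ 0 :: w) = 0 := by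
  obtain ⟨f, hf⟩ := exists_linearMap_evalOn x v w h
  rw [hf, map_zero]

theorem evalOn_ofFn {n : ℕ} (x : MultilinearMap k (fun _ : Fin n => A) A) (a : Fin n → A) :
    evalOn x (List.ofFn a) = x a := by
  simp [evalOn, List.getD_eq_getElem?_getD]

theorem evalOn_domDomCongr {n n' : ℕ} (h : n = n')
    (x : MultilinearMap k (fun _ : Fin n => A) A) (w : List A) :
    evalOn (x.domDomCongr (finCongr h)) w = evalOn x w := by
  subst h; rfl

theorem evalOn_zero {n : ℕ} (w : List A) :
    evalOn (0 : MultilinearMap k (fun _ : Fin n => A) A) w = 0 := rfl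

end EvalOn

/-! ### Words and signs -/

section Words

variable {ι : Type}

theorem splitLengths_replicate_one {α : Type*} (v : List α) :
    (List.replicate v.length 1).splitLengths v = v.map fun i => [i] := by
  induction v with
  | nil => rfl
  | cons i v ih => simp [List.replicate_succ, ih]

/-- The middle part has length 1 and uses up the slot, so nothing remains on either side. -/
theorem subdivisions_singletons {α : Type*} (v : List α) :
    subdivisions (List.replicate v.length 1) (v.map fun i => [i]) =
      [v.map fun i => ([], [i], [])] := by
  induction v with
  | nil => rfl
  | cons i v ih => simp [List.replicate_succ, subdivisions, splits, ih]

theorem shuffles_eq_of_forall_nil {α : Type*} :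
    ∀ vs : List (List α), (∀ v ∈ vs, v = []) → shuffles vs = [[]]
  | [], _ => rfl
  | v :: vs, h => by
    obtain rfl : v = [] := h v (by simp)
    simp [shuffles, shuffles_eq_of_forall_nil vs fun v hv => h v (by simp [hv]), shuffle]

/-- A nonempty `c` guarantees that a bar follows the last slot of `vs`. -/
theorem slotWord_append_left (c : List (List ι)) (hc : c ≠ []) :
    ∀ (q : ℕ) (vs : List (List ι)), slotWord q (vs ++ c) =
      ((vs.zipIdx q).flatMap fun v => v.1.map Symb.arg ++ [Symb.bar v.2]) ++
        slotWord (q + vs.length) c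
  | q, [] => by simp
  | q, [v] => by
    obtain ⟨d, c, rfl⟩ := List.exists_cons_of_ne_nil hc
    simp [slotWord]
  | q, v :: w :: vs => by
    have := slotWord_append_left c hc (q + 1) (w :: vs)
    simp only [List.cons_append] at this
    simp only [List.cons_append, slotWord, this, List.zipIdx_cons, List.flatMap_cons]
    simp [add_assoc, add_comm 1]

/-- The slots of `c` are separated by `c.length - 1` bars, which gives the number of the next bar;
the subtraction does not truncate because `c` is nonempty. -/
theorem slotWord_append_right (vs : List (List ι)) :
    ∀ (q : ℕ) (c : List (List ι)), c ≠ [] → slotWord q (c ++ vs) =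
      slotWord q c ++ wordAfter (q + c.length - 1) vs
  | q, [v], _ => by
    have key : ∀ (vs : List (List ι)) (q : ℕ) (v : List ι),
        slotWord q (v :: vs) = v.map Symb.arg ++ wordAfter q vs := by
      intro vs
      induction vs with
      | nil => simp [slotWord, wordAfter]
      | cons w vs ih => intro q v; simp [slotWord, wordAfter, ih]
    simp [slotWord, key]
  | q, v :: w :: c, _ => by
    have := slotWord_append_right vs (q + 1) (w :: c) (by simp)
    simp only [List.cons_append] at this
    simp only [List.cons_append, slotWord, this]
    simp [add_assoc, add_comm 1]

theorem slotWord_append (pre c post : List (List ι)) (hc : c ≠ []) :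
    slotWord 0 (pre ++ c ++ post) = wordBefore pre ++ slotWord pre.length c ++
      wordAfter (pre.length + c.length - 1) post := by
  rw [List.append_assoc, slotWord_append_left _ (by simp [hc]), slotWord_append_right _ _ _ hc]
  simp [wordBefore]

theorem op_notMem_slotWord : ∀ (q : ℕ) (vs : List (List ι)), Symb.op ∉ slotWord q vs
  | _, [] => by simp [slotWord]
  | _, [v] => by simp [slotWord]
  | q, v :: w :: vs => by
    simp [slotWord, op_notMem_slotWord (q + 1) (w :: vs)]

theorem mem_flatten_of_arg_mem_slotWord {i : ι} : ∀ {q : ℕ} {vs : List (List ι)},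
    Symb.arg i ∈ slotWord q vs → i ∈ vs.flatten
  | _, [], h => by simp [slotWord] at h
  | _, [v], h => by simpa [slotWord] using h
  | q, v :: w :: vs, h => by
    simp only [slotWord, List.mem_append, List.mem_map, Symb.arg.injEq, exists_eq_right,
      List.mem_cons, reduceCtorEq, false_or] at h
    rcases h with h | h
    · simp [h]
    · have := mem_flatten_of_arg_mem_slotWord h
      rw [List.flatten_cons, List.mem_append]
      exact Or.inr this

theorem le_of_bar_mem_slotWord {j : ℕ} : ∀ {q : ℕ} {vs : List (List ι)},
    Symb.bar j ∈ slotWord q vs → q ≤ j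
  | _, [], h => by simp [slotWord] at h
  | _, [v], h => by simp [slotWord] at h
  | q, v :: w :: vs, h => by
    simp only [slotWord, List.mem_append, List.mem_map, reduceCtorEq, and_false, exists_false,
      List.mem_cons, Symb.bar.injEq, false_or] at h
    rcases h with h | h
    · exact h.ge
    · exact (Nat.le_succ q).trans (le_of_bar_mem_slotWord h)

/-- `koszulSign` compares positions through `idxOf`, which is meaningful only without repeated
symbols. The numbering of the bars keeps them distinct. -/
theorem nodup_slotWord : ∀ (q : ℕ) (vs : List (List ι)), vs.flatten.Nodup → (slotWord q vs).Nodup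
  | _, [], _ => by simp [slotWord]
  | _, [v], h => by
    simp only [List.flatten_cons, List.flatten_nil, List.append_nil] at h
    exact h.map fun _ _ => Symb.arg.inj
  | q, v :: w :: vs, h => by
    rw [List.flatten_cons, List.nodup_append'] at h
    rw [slotWord, List.nodup_append']
    refine ⟨h.1.map fun _ _ => Symb.arg.inj, List.nodup_cons.mpr
      ⟨fun hb => absurd (le_of_bar_mem_slotWord hb) (by omega), nodup_slotWord _ _ h.2.1⟩, ?_⟩
    intro s hs hs'
    obtain ⟨i, hi, rfl⟩ := List.mem_map.mp hs
    simp only [List.mem_cons, reduceCtorEq, false_or] at hs'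
    exact h.2.2 hi (mem_flatten_of_arg_mem_slotWord hs')

theorem pairwise_idxOf_lt {S : Type*} [DecidableEq S] {w : List S} (h : w.Nodup) :
    w.Pairwise fun u v => w.idxOf u < w.idxOf v := by
  rw [List.pairwise_iff_getElem]
  intro i j hi hj hij
  rwa [h.idxOf_getElem, h.idxOf_getElem]

theorem koszulSign_eq_one {S : Type} [DecidableEq S] (deg : S → ℤ) (old : List S) :
    ∀ new : List S, (new.Pairwise fun u v => old.idxOf u < old.idxOf v) →
      koszulSign deg old new = 1
  | [], _ => rfl
  | u :: new, h => by
    rw [List.pairwise_cons] at h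
    rw [koszulSign, koszulSign_eq_one deg old new h.2, List.filter_eq_nil_iff.mpr]
    · simp
    · intro v hv
      simpa using (h.1 v hv).le

/-- The recursion shortens the new word but keeps `old`, so the induction needs hypotheses on
positions in `old` instead of a fixed shape of `old`. -/
theorem koszulSign_move {S : Type} [DecidableEq S] (deg : S → ℤ) (old : List S) (y : S)
    (w : List S) (hy : (y :: w).Pairwise fun u v => old.idxOf u < old.idxOf v) :
    ∀ v : List S, ((v ++ w).Pairwise fun u v => old.idxOf u < old.idxOf v) →
      (∀ u ∈ v, old.idxOf y < old.idxOf u) →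
      koszulSign deg old (v ++ y :: w) = (deg y * (v.map deg).sum).negOnePow
  | [], _, _ => by simpa using koszulSign_eq_one deg old _ hy
  | u :: v, h, hv => by
    simp only [List.cons_append, List.pairwise_cons] at h
    rw [List.cons_append, koszulSign, koszulSign_move deg old y w hy v h.2
      fun u hu => hv u (by simp [hu])]
    -- Only `y` stands behind `u` now and preceded it in `old`.
    have hf : ((v ++ y :: w).filter fun z => decide (old.idxOf z < old.idxOf u)) = [y] := by
      rw [List.filter_append, List.filter_cons, if_pos (by simpa using hv u (by simp)),
        List.filter_eq_nil_iff.mpr, List.filter_eq_nil_iff.mpr]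
      · rfl
      · intro z hz
        simpa using (h.1 z (by simp [hz])).le
      · intro z hz
        simpa using (h.1 z (by simp [hz])).le
    rw [hf]
    simp only [List.map_cons, List.map_nil, List.prod_cons, List.prod_nil, mul_one, List.sum_cons,
      mul_add, Int.negOnePow_add, mul_comm (deg u)]

/-- Moving the first letter of a word to the right past the letters of `v`. -/
theorem koszulSign_cons_append {S : Type} [DecidableEq S] (deg : S → ℤ) (y : S) (v w : List S)
    (h : (y :: (v ++ w)).Nodup) :
    koszulSign deg (y :: (v ++ w)) (v ++ y :: w) = (deg y * (v.map deg).sum).negOnePow := by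
  have hp := pairwise_idxOf_lt h
  have hp' := List.pairwise_cons.mp hp
  refine koszulSign_move deg _ y w (hp.sublist ?_) v hp'.2 fun u hu => hp'.1 u (by simp [hu])
  simp

/-- An argument of degree `|a| - 1` and the bar behind it have total degree `|a|`. -/
theorem sum_degree_wordBefore (q : ℤ) (p : ι → ℤ) (v : List ι) :
    ((wordBefore (v.map fun i => [i])).map (Symb.degree q p)).sum = (v.map p).sum := by
  have key : ∀ (v : List ι) (j : ℕ), ((((v.map fun i => [i]).zipIdx j).flatMap fun v =>
      v.1.map Symb.arg ++ [Symb.bar v.2]).map (Symb.degree q p)).sum = (v.map p).sum := by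
    intro v
    induction v with
    | nil => simp
    | cons i v ih =>
      intro j
      simp only [List.map_cons, List.zipIdx_cons, List.flatMap_cons, List.map_append,
        List.sum_append, ih]
      simp [Symb.degree]
  exact key v 0

end Words

/-! ### Compositions of maps without zero slots -/

section Comp

variable {k : Type*} [Field k] {A : Type*} [AddCommGroup A] [Module k A]

theorem length_of_mem_shuffle {α : Type*} : ∀ {v w u : List α}, u ∈ shuffle v w →
    u.length = v.length + w.length
  | [], w, u, h => by simp_all [shuffle]
  | x :: v, [], u, h => by simp_all [shuffle]
  | x :: v, y :: w, u, h => by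
    simp only [shuffle, List.mem_append, List.mem_map] at h
    rcases h with ⟨z, hz, rfl⟩ | ⟨z, hz, rfl⟩
    · have := length_of_mem_shuffle hz
      simp only [List.length_cons] at this ⊢
      omega
    · have := length_of_mem_shuffle hz
      simp only [List.length_cons] at this ⊢
      omega

theorem length_of_mem_shuffles {α : Type*} : ∀ {vs : List (List α)} {u : List α},
    u ∈ shuffles vs → u.length = vs.flatten.length
  | [], u, h => by simp_all [shuffles]
  | v :: vs, u, h => by
    simp only [shuffles, List.mem_flatMap] at h
    obtain ⟨z, hz, hu⟩ := h
    rw [length_of_mem_shuffle hu, length_of_mem_shuffles hz, List.flatten_cons,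
      List.length_append]

theorem comp_zero_left {π ρ : OrdPartition} (y : MultilinearMap k (fun _ : Fin ρ.args => A) A)
    (q : ℤ) (τ : OrdPartition) (p : Fin τ.args → ℤ) (a : Fin τ.args → A) :
    comp (π := π) 0 y q τ p a = 0 := by
  simp [comp, evalOn_zero]

theorem comp_zero_right {π ρ : OrdPartition} (x : MultilinearMap k (fun _ : Fin π.args => A) A)
    (q : ℤ) (τ : OrdPartition) (p : Fin τ.args → ℤ) (a : Fin τ.args → A) :
    comp (ρ := ρ) x 0 q τ p a = 0 := by
  refine Finset.sum_eq_zero fun l hl => ?_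
  dsimp only
  split_ifs with h
  · refine List.sum_eq_zero fun z hz => ?_
    obtain ⟨S, -, rfl⟩ := List.mem_map.mp hz
    split_ifs with hS
    · refine List.sum_eq_zero fun z hz => ?_
      obtain ⟨B, hB, rfl⟩ := List.mem_map.mp hz
      refine List.sum_eq_zero fun z hz => ?_
      obtain ⟨D, -, rfl⟩ := List.mem_map.mp hz
      -- The inserted zero must stand at an actual argument of `x`, since `evalOn` ignores letters
      -- further on. This holds because `B` is shorter than slot `l` and the slots before it have
      -- the prescribed lengths.
      have hl' : l < π.1.length := Finset.mem_range.mp hl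
      have hB' := length_of_mem_shuffles hB
      have h1 := congrArg List.sum h.1
      have h2 := List.sum_take_add_sum_drop π.1 l
      rw [List.drop_eq_getElem_cons hl', List.sum_cons] at h2
      rw [List.getD_eq_getElem _ _ hl'] at hS
      rw [← List.length_flatten] at h1
      have h0 := evalOn_append_zero x ((τ.slots.take l).flatten.map a ++ B.map a)
        (D.map a ++ (τ.slots.drop (l + ρ.1.length)).flatten.map a) (by
          simp only [List.length_append, List.length_map, OrdPartition.args]
          omega)
      rw [← List.cons_append, ← List.append_assoc] at h0
      rw [evalOn_zero, h0, smul_zero]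
    · rfl
  · rfl

theorem slots_ones (N : ℕ) :
    (ones N).slots = (List.finRange (ones N).args).map fun i => [i] := by
  have h : (ones N).1 = List.replicate (List.finRange (ones N).args).length 1 := by
    rw [List.length_finRange, args_ones]; rfl
  unfold OrdPartition.slots
  conv_lhs => arg 1; rw [h]
  exact splitLengths_replicate_one _

theorem flatten_singletons {α : Type*} (v : List α) : (v.map fun i => [i]).flatten = v := by
  induction v with
  | nil => rfl
  | cons i v ih => simp [ih]

theorem map_length_singletons {α : Type*} (v : List α) :
    (v.map fun i => [i]).map List.length = List.replicate v.length 1 := by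
  induction v with
  | nil => rfl
  | cons i v ih => simpa [List.replicate_succ] using ih

/-- A slot of size 1 has room only for the value of `y`. Thus each `l` contributes one term, and its
sign comes from moving `y` past the first `l` arguments with their bars. -/
theorem comp_ones {M S N : ℕ} (hN : M + S = N)
    (x : MultilinearMap k (fun _ : Fin (ones M).args => A) A)
    (y : MultilinearMap k (fun _ : Fin (ones S).args => A) A) (q : ℤ)
    (p : Fin (ones N).args → ℤ) (a : Fin (ones N).args → A) :
    comp x y q (ones N) p a =
      ∑ l ∈ Finset.range (M + 1),
        (q * (((List.finRange _).take l).map p).sum).negOnePow •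
          evalOn x (((List.finRange _).take l).map a ++
            evalOn y ((((List.finRange _).drop l).take (S + 1)).map a) ::
              ((List.finRange _).drop (l + (S + 1))).map a) := by
  have hlM : (ones M).1.length = M + 1 := by simp [ones]
  have hlS : (ones S).1.length = S + 1 := by simp [ones]
  unfold comp
  rw [hlM, hlS]
  refine Finset.sum_congr rfl fun l hl => ?_
  have hl : l ≤ M := Nat.lt_succ_iff.mp (Finset.mem_range.mp hl)
  dsimp only
  rw [slots_ones]
  simp only [← List.map_take, ← List.map_drop]
  have hL : (List.finRange (ones N).args).length = M + S + 1 := by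
    rw [List.length_finRange, args_ones, hN]
  have hnd := List.nodup_finRange (ones N).args
  generalize List.finRange (ones N).args = L at hL hnd ⊢
  -- The arguments before, inside and behind the inner map.
  have hLs : L = L.take l ++ (L.drop l).take (S + 1) ++ L.drop (l + (S + 1)) := by
    rw [List.append_assoc, ← List.drop_drop, List.take_append_drop, List.take_append_drop]
  have hP : (L.take l).length = l := by rw [List.length_take]; omega
  have hC : ((L.drop l).take (S + 1)).length = S + 1 := by
    rw [List.length_take, List.length_drop]; omega
  have hQ : (L.drop (l + (S + 1))).length = M - l := by rw [List.length_drop]; omega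
  generalize L.take l = P at *
  generalize (L.drop l).take (S + 1) = C at *
  generalize L.drop (l + (S + 1)) = Q at *
  subst hLs
  have hone : (ones S).1 = List.replicate C.length 1 := by rw [hC]; rfl
  have h1 : (P.map fun i => [i]).map List.length = (ones M).1.take l := by
    rw [map_length_singletons, hP]
    simp [ones, List.take_replicate, hl.trans (Nat.le_succ M)]
  have h2 : (Q.map fun i => [i]).map List.length = (ones M).1.drop (l + 1) := by
    rw [map_length_singletons, hQ]
    simp [ones, List.drop_replicate]
  have h3 : (ones M).1.getD l 0 = 1 := by
    simp [ones, List.getD_eq_getElem?_getD, Nat.lt_succ_of_le hl]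
  rw [if_pos ⟨h1, h2⟩, hone, subdivisions_singletons, h3]
  have hnil : (C.map fun _ => ([] : List (Fin (ones N).args))).flatten = [] := by simp
  have hb : shuffles (C.map fun _ => ([] : List (Fin (ones N).args))) = [[]] :=
    shuffles_eq_of_forall_nil _ fun v hv => by
      obtain ⟨_, -, rfl⟩ := List.mem_map.mp hv; rfl
  simp only [List.map_cons, List.map_nil, List.map_map, Function.comp_def, List.sum_cons,
    List.sum_nil, add_zero, hnil, hb, List.length_nil, zero_add, if_true, flatten_singletons,
    List.append_nil]
  have hword : slotWord 0 ((P ++ C ++ Q).map fun i => [i]) =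
      wordBefore (P.map fun i => [i]) ++ (slotWord l (C.map fun i => [i]) ++
        wordAfter (l + (S + 1) - 1) (Q.map fun i => [i])) := by
    rw [List.map_append, List.map_append, slotWord_append, List.length_map, List.length_map, hP,
      hC, List.append_assoc]
    intro h
    rw [List.map_eq_nil_iff] at h
    simp [h] at hC
  have hsign : koszulSign (Symb.degree q p) (Symb.op :: slotWord 0 ((P ++ C ++ Q).map fun i => [i]))
      (wordBefore (P.map fun i => [i]) ++ (Symb.op :: (slotWord l (C.map fun i => [i]) ++
        wordAfter (l + (S + 1) - 1) (Q.map fun i => [i])))) =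
      (q * (P.map p).sum).negOnePow := by
    rw [hword, koszulSign_cons_append, sum_degree_wordBefore]
    · rfl
    · rw [← hword]
      refine List.nodup_cons.mpr ⟨op_notMem_slotWord _ _, nodup_slotWord _ _ ?_⟩
      rwa [flatten_singletons]
  simp only [List.append_assoc, List.cons_append, List.nil_append] at hsign ⊢
  rw [hsign]

end Comp

/-! ### The part `m_B` and its master identity -/

section PartB

variable {k : Type*} [Field k] {A : Type*} [AddCommGroup A] [Module k A]
  {𝒜 : ℤ → Submodule k A}

theorem eq_ones_iff (π : OrdPartition) :
    (∀ i ∈ π.1, i = 1) ↔ π = ones (π.1.length - 1) := by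
  have hpos := List.length_pos_iff.mpr π.2
  constructor
  · intro h
    refine Subtype.ext ?_
    rw [List.eq_replicate_of_mem h]
    simp [ones, Nat.sub_add_cancel hpos]
  · intro h i hi
    rw [h] at hi
    exact List.eq_of_mem_replicate hi

theorem partB_map_ones (m : PartitionedSum 𝒜) (n : ℕ) : m.partB.map (ones n) = m.map (ones n) :=
  if_pos fun _ hi => List.eq_of_mem_replicate hi

theorem partB_map_eq_zero (m : PartitionedSum 𝒜) {π : OrdPartition} (h : ¬ ∀ i ∈ π.1, i = 1) :
    m.partB.map π = 0 :=
  if_neg h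

theorem length_of_mem_star {τ π ρ : OrdPartition} (h : τ ∈ π.star ρ) :
    τ.1.length + 1 = π.1.length + ρ.1.length := by
  obtain ⟨pre, post, u, i, h1, h2, h3, h4⟩ := h
  rw [h4, h1]
  simp [h2]
  omega

/-- The absence of zeros in `v` excludes the decomposition `1 = 0 + 1`. -/
theorem eq_one_of_zipWith_add : ∀ {v u : List ℕ}, u.length = v.length →
    (∀ i ∈ List.zipWith (· + ·) v u, i = 1) → 0 ∉ v → (∀ i ∈ v, i = 1) ∧ u.sum = 0
  | [], [], _, _, _ => by simp
  | a :: v, b :: u, hl, h, h0 => by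
    simp only [List.zipWith_cons_cons, List.mem_cons, forall_eq_or_imp, not_or] at h h0
    have := eq_one_of_zipWith_add (by simpa using hl) h.2 h0.2
    simp only [List.mem_cons, forall_eq_or_imp, List.sum_cons, this.2]
    exact ⟨⟨by omega, this.1⟩, by omega⟩

/-- A partition `(1|⋯|1)` occurs in `π ∗ ρ`, where `ρ` has no zero slots, only if both `π` and `ρ`
are of this form. -/
theorem eq_one_of_ones_mem_star {τ π ρ : OrdPartition} (hτ : ∀ i ∈ τ.1, i = 1)
    (h : τ ∈ π.star ρ) (hρ : ¬ ρ.HasZeroSlot) : (∀ i ∈ π.1, i = 1) ∧ ∀ i ∈ ρ.1, i = 1 := by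
  obtain ⟨pre, post, u, i, h1, h2, h3, h4⟩ := h
  rw [h4] at hτ
  obtain ⟨hv, hu⟩ := eq_one_of_zipWith_add h2 (fun i hi => hτ i (by simp [hi])) hρ
  refine ⟨fun j hj => ?_, hv⟩
  rw [h1] at hj
  simp only [List.mem_append, List.mem_cons] at hj
  rcases hj with hj | rfl | hj
  · exact hτ j (by simp [hj])
  · omega
  · exact hτ j (by simp [hj])

theorem ones_mem_star (M S : ℕ) : ones (M + S) ∈ (ones M).star (ones S) := by
  -- The first slot of `ones M` is replaced, without additional arguments.
  refine ⟨[], List.replicate M 1, List.replicate (S + 1) 0, 1, ?_, ?_, ?_, ?_⟩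
  · simp [ones, List.replicate_succ]
  · simp [ones]
  · simp
  · simp only [ones, List.nil_append, List.zipWith_replicate, min_self, add_zero,
      List.replicate_append_replicate]
    congr 1
    omega

/-- The replaced slot is 1, so no additional arguments `u` are left to enlarge the slots of `ρ`. -/
theorem eq_one_of_mem_star {τ π ρ : OrdPartition} (h : τ ∈ π.star ρ)
    (hπ : ∀ i ∈ π.1, i = 1) (hρ : ∀ i ∈ ρ.1, i = 1) : ∀ i ∈ τ.1, i = 1 := by
  rw [eq_ones_iff] at hπ hρ
  obtain ⟨pre, post, u, i, h1, h2, h3, h4⟩ := h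
  rw [hπ] at h1
  have h1' : ∀ j ∈ pre ++ i :: post, j = 1 := fun j hj => by
    rw [← h1] at hj
    exact List.eq_of_mem_replicate hj
  have hu : ∀ j ∈ u, j = 0 := fun j hj => by
    have := List.le_sum_of_mem hj
    have := h1' i (by simp)
    omega
  rw [h4, List.eq_replicate_of_mem hu, hρ]
  intro j hj
  simp only [ones, List.zipWith_replicate, List.mem_append, List.mem_replicate] at hj
  rcases hj with (hj | hj) | hj
  · exact h1' j (by simp [hj])
  · exact hj.2
  · exact h1' j (by simp [hj])

variable [DirectSum.Decomposition 𝒜]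

theorem tilde_zero {n : ℕ} :
    tilde 𝒜 (0 : MultilinearMap k (fun _ : Fin n => A) A) = 0 :=
  MultilinearMap.zero_compLinearMap _

/-- The part `m_B` satisfies the master identity. -/
theorem masterIdentity_partB (m : PartitionedSum 𝒜) (hm : MasterIdentity m)
    (hzero : ∀ π : OrdPartition, π.HasZeroSlot → m.map π = 0) : MasterIdentity m.partB := by
  intro τ p a ha
  by_cases hτ : ∀ i ∈ τ.1, i = 1
  · rw [← hm τ p a ha]
    refine Finset.sum_congr rfl fun P hP => ?_
    have hstar : τ ∈ OrdPartition.star P.1 P.2 := OrdPartition.mem_factorPairs.mp hP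
    -- Zero slots do occur here: `(1|1)` is a term of `(2) ∗ (0|1)`. Such terms vanish for `m` by
    -- `hzero` and for `m_B` by definition.
    by_cases hρ : P.2.HasZeroSlot
    · rw [partB_map_eq_zero m fun h => absurd (h 0 hρ) (by simp), hzero _ hρ, tilde_zero,
        comp_zero_right, comp_zero_right]
    · obtain ⟨h1, h2⟩ := eq_one_of_ones_mem_star hτ hstar hρ
      rw [show m.partB.map P.1 = m.map P.1 from if_pos h1,
        show m.partB.map P.2 = m.map P.2 from if_pos h2]
      rfl
  · refine Finset.sum_eq_zero fun P hP => ?_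
    have hstar : τ ∈ OrdPartition.star P.1 P.2 := OrdPartition.mem_factorPairs.mp hP
    by_cases hπ : ∀ i ∈ P.1.1, i = 1
    · rw [partB_map_eq_zero m fun h => hτ (eq_one_of_mem_star hstar hπ h), tilde_zero,
        comp_zero_right]
    · rw [partB_map_eq_zero m hπ, tilde_zero, comp_zero_left]

/-- The master identity for `m_B` in arity `N + 1`, as a sum over the arity of the inner map. -/
theorem sum_comp_ones (m : PartitionedSum 𝒜) (hm : MasterIdentity m.partB) (N : ℕ)
    (p : Fin (ones N).args → ℤ) (a : Fin (ones N).args → A) (ha : ∀ i, a i ∈ 𝒜 (p i)) :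
    ∑ s ∈ Finset.Icc 1 (N + 1), comp (tilde 𝒜 (m.map (ones (N + 1 - s))))
      (tilde 𝒜 (m.map (ones (s - 1)))) (m.totalDegree (ones (s - 1))) (ones N) p a = 0 := by
  rw [← hm (ones N) p a ha]
  have hinj : Function.Injective ones := fun i j h => by
    simpa [ones] using congrArg (fun π : OrdPartition => π.1.length) h
  -- The index `s` is the number of slots of the inner partition; `ones n` has `n + 1` slots, whence
  -- the indices `s - 1` and `N + 1 - s`.
  refine Finset.sum_of_injOn (fun s => (ones (N + 1 - s), ones (s - 1))) ?_ ?_ ?_ ?_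
  · intro s hs t ht h
    have : s - 1 = t - 1 := hinj (Prod.ext_iff.mp h).2
    simp only [Finset.coe_Icc, Set.mem_Icc] at hs ht
    omega
  · intro s hs
    simp only [Finset.coe_Icc, Set.mem_Icc] at hs
    rw [Finset.mem_coe, OrdPartition.mem_factorPairs]
    have := ones_mem_star (N + 1 - s) (s - 1)
    rwa [show N + 1 - s + (s - 1) = N by omega] at this
  -- A pair outside the image has a factor with a slot different from 1, since otherwise counting
  -- slots would place it in the image.
  · rintro ⟨π, ρ⟩ hP hP'
    by_cases hπ : ∀ i ∈ π.1, i = 1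
    · by_cases hρ : ∀ i ∈ ρ.1, i = 1
      · exfalso
        apply hP'
        have hl := length_of_mem_star (OrdPartition.mem_factorPairs.mp hP)
        have hτ : (ones N).1.length = N + 1 := by simp [ones]
        have h1 := List.length_pos_iff.mpr π.2
        have h2 := List.length_pos_iff.mpr ρ.2
        refine ⟨ρ.1.length, by simp only [Finset.coe_Icc, Set.mem_Icc]; omega, ?_⟩
        refine Prod.ext ?_ ((eq_ones_iff ρ).mp hρ).symm
        rw [(eq_ones_iff π).mp hπ]
        simp only
        congr 1
        omega
      · dsimp only
        rw [partB_map_eq_zero m hρ, tilde_zero, comp_zero_right]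
    · dsimp only
      rw [partB_map_eq_zero m hπ, tilde_zero, comp_zero_left]
  · intro s _
    simp only [partB_map_ones]
    rfl

end PartB

/-! ### The `A∞` relations -/

section AInfinity

/-- The exponent of the sign of `x̃` at a word of elements of degrees `p`. -/
def tildeExponent : List ℤ → ℤ
  | [] => 0
  | d :: p => p.length * (d - 1) + tildeExponent p

/-- The weight of a letter is the number of letters behind it, so appending `q` raises each weight
in `p` by `q.length`. -/
theorem tildeExponent_append : ∀ p q : List ℤ, tildeExponent (p ++ q) =
    tildeExponent p + q.length * (p.sum - p.length) + tildeExponent q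
  | [], q => by simp [tildeExponent]
  | d :: p, q => by
    simp only [List.cons_append, tildeExponent, tildeExponent_append p q, List.length_append,
      List.sum_cons, List.length_cons]
    push_cast
    ring

theorem prod_negOnePow_eq_tildeExponent : ∀ p : List ℤ,
    ∏ i : Fin p.length, (((p.length - 1 - (i : ℕ) : ℕ) : ℤ) * (p[i] - 1)).negOnePow =
      (tildeExponent p).negOnePow
  | [] => rfl
  | d :: p => by
    simp only [List.length_cons]
    rw [Fin.prod_univ_succ, tildeExponent, Int.negOnePow_add, ← prod_negOnePow_eq_tildeExponent p]
    congr 1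
    refine Finset.prod_congr rfl fun i _ => ?_
    congr 3
    simp only [Fin.val_succ]
    omega

variable {k : Type*} [Field k] {A : Type*} [AddCommGroup A] [Module k A]

theorem evalOn_eq_apply_getElem {n : ℕ} (x : MultilinearMap k (fun _ : Fin n => A) A) (w : List A)
    (h : w.length = n) : evalOn x w = x fun i => w[i] := by
  rw [evalOn]
  congr 1
  funext i
  exact List.getD_eq_getElem _ _ _

theorem evalOn_mem {𝒜 : ℤ → Submodule k A} {n : ℕ}
    {x : MultilinearMap k (fun _ : Fin n => A) A} {s : ℤ} (hx : IsHomogeneousOfDegree 𝒜 x s)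
    {w : List A} {p : List ℤ} (hw : List.Forall₂ (fun b d => b ∈ 𝒜 d) w p) (hn : w.length = n) :
    evalOn x w ∈ 𝒜 (p.sum + s) := by
  have hp : n = p.length := hn ▸ hw.length_eq
  rw [evalOn_eq_apply_getElem x w hn]
  convert hx (fun i => p[i]) (fun i => w[i]) fun i => ?_
  · subst hp
    simp
  · exact hw.get _ _

variable {𝒜 : ℤ → Submodule k A} [DirectSum.Decomposition 𝒜]

theorem signMap_pow_of_mem {n : ℤ} {b : A} (hb : b ∈ 𝒜 n) (e : ℕ) :
    (signMap 𝒜 ^ e) b = ((e : ℤ) * (n - 1)).negOnePow • b := by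
  induction e with
  | zero => simp
  | succ e ih =>
    rw [pow_succ, Module.End.mul_apply, signMap_of_mem 𝒜 hb, Units.smul_def, map_zsmul, ih,
      ← Units.smul_def, smul_smul, ← Int.negOnePow_add]
    congr 2
    push_cast
    ring

theorem evalOn_tilde {n : ℕ} (x : MultilinearMap k (fun _ : Fin n => A) A) {w : List A}
    {p : List ℤ} (hw : List.Forall₂ (fun b d => b ∈ 𝒜 d) w p) (hn : w.length = n) :
    evalOn (tilde 𝒜 x) w = (tildeExponent p).negOnePow • evalOn x w := by
  have hp : n = p.length := hn ▸ hw.length_eq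
  rw [evalOn_eq_apply_getElem _ w hn, evalOn_eq_apply_getElem _ w hn, tilde,
    MultilinearMap.compLinearMap_apply, ← prod_negOnePow_eq_tildeExponent]
  subst hp
  have h : ∀ i : Fin p.length, (signMap 𝒜 ^ (p.length - 1 - (i : ℕ))) w[i] =
      (((((p.length - 1 - (i : ℕ) : ℕ) : ℤ) * (p[i] - 1)).negOnePow : ℤ) : k) • w[i] := fun i => by
    have hi : w[i] ∈ 𝒜 p[i] := hw.get _ _
    rw [signMap_pow_of_mem hi, Int.cast_smul_eq_zsmul, Units.smul_def]
  simp only [h]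
  -- As scalars in `k`, the signs can be extracted from all arguments at once.
  rw [MultilinearMap.map_smul_univ, ← Int.cast_prod, Int.cast_smul_eq_zsmul, ← Units.coe_prod,
    Units.smul_def]

omit [DirectSum.Decomposition 𝒜] in
theorem forall₂_map_mem {ι : Type*} {p : ι → ℤ} {a : ι → A} (ha : ∀ i, a i ∈ 𝒜 (p i))
    (v : List ι) : List.Forall₂ (fun b d => b ∈ 𝒜 d) (v.map a) (v.map p) := by
  rw [List.forall₂_map_left_iff, List.forall₂_map_right_iff, List.forall₂_same]
  exact fun i _ => ha i

/-- The signs of `{m̃}{m̃}` and of the `A∞` relations differ by the sign of `m̃`. -/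
theorem smul_evalOn_tilde_tilde {ι : Type*} {M S : ℕ}
    (x : MultilinearMap k (fun _ : Fin M => A) A) (y : MultilinearMap k (fun _ : Fin S => A) A) {e q : ℤ} (he : Odd e) (hq : Odd q)
    (hy : IsHomogeneousOfDegree 𝒜 y e) {p : ι → ℤ} {a : ι → A} (ha : ∀ i, a i ∈ 𝒜 (p i))
    (u v w : List ι) (hv : v.length = S)
    (huw : u.length + w.length + 1 = M) :
    (q * (u.map p).sum).negOnePow • evalOn (tilde 𝒜 x)
        (u.map a ++ evalOn (tilde 𝒜 y) (v.map a) :: w.map a) =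
      ((tildeExponent ((u ++ v ++ w).map p)).negOnePow *
        ((u.length : ℤ) + v.length * w.length + v.length * ((u.map p).sum - u.length)).negOnePow) •
        evalOn x (u.map a ++ evalOn y (v.map a) :: w.map a) := by
  rw [evalOn_tilde y (forall₂_map_mem ha v) (by simp [hv]),
    evalOn_units_smul _ _ _ (by simp; omega)]
  have hmem := evalOn_mem hy (forall₂_map_mem ha v) (by simp [hv])
  rw [evalOn_tilde (𝒜 := 𝒜) x
    (List.rel_append (forall₂_map_mem ha u) (List.Forall₂.cons hmem (forall₂_map_mem ha w)))
    (by simp; omega), smul_smul, smul_smul]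
  congr 1
  rw [← Int.negOnePow_add, ← Int.negOnePow_add, ← Int.negOnePow_add]
  refine negOnePow_congr ?_
  obtain ⟨e, rfl⟩ := he
  obtain ⟨q, rfl⟩ := hq
  simp only [List.map_append, tildeExponent_append, tildeExponent, List.length_append,
    List.length_map, List.length_cons, List.sum_append]
  push_cast
  generalize (List.map p u).sum = su
  generalize (List.map p v).sum = sv
  generalize (u.length : ℤ) = r
  generalize (v.length : ℤ) = s
  generalize (w.length : ℤ) = t
  -- Half the difference of the two exponents, the odd degrees being written as `2 * e + 1` and `2 *
  -- q + 1`.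
  exact ⟨q * su + su - su * s + t * e - r + r * s, by ring⟩

end AInfinity

/-! ### The operations on the shifted space -/

section OpsB

variable {k : Type*} [Field k] {A : Type*} [AddCommGroup A] [Module k A]
  {𝒜 : ℤ → Submodule k A}

/-- For `ones n` both `d` and `d̄` equal `n`, so they cancel modulo 2. -/
theorem odd_of_modEq_d_add_dBar (n : ℕ) {e : ℤ}
    (h : e ≡ (ones n).d + (ones n).dBar + 1 [ZMOD 2]) : Odd e := by
  rw [Int.odd_iff, h.eq]
  simp only [OrdPartition.d, OrdPartition.dBar, ones, List.sum_replicate, List.length_replicate]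
  push_cast
  simp only [smul_eq_mul]
  push_cast
  omega

theorem odd_totalDegree (m : PartitionedSum 𝒜) (n : ℕ)
    (h : m.superDegree (ones n) ≡ (ones n).d + (ones n).dBar + 1 [ZMOD 2]) :
    Odd (m.totalDegree (ones n)) := by
  have h' := Int.odd_iff.mp (odd_of_modEq_d_add_dBar n h)
  rw [Int.odd_iff, PartitionedSum.totalDegree]
  simp only [OrdPartition.d, OrdPartition.dBar, ones, List.sum_replicate, List.length_replicate,
    smul_eq_mul] at h' ⊢
  push_cast at h' ⊢
  omega

/-- The shift affects `n + 1` inputs and one output, a net change of `n`. Together with the odd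
super degree this gives the parity of the arity `n + 1`. -/
theorem isHomogeneousOfDegree_opsB (m : PartitionedSum 𝒜) (n : ℕ) :
    IsHomogeneousOfDegree (shift 𝒜) (m.opsB (n + 1)) (n + m.superDegree (ones n)) := by
  intro p a ha
  have h := m.isHomogeneous (ones n) (fun i => p (finCongr (args_ones n) i) + 1)
    (fun i => a (finCongr (args_ones n) i)) fun i => ha _
  have hs : ∑ i, (p (finCongr (args_ones n) i) + 1) = ∑ i, (p i + 1) :=
    Equiv.sum_comp (finCongr (args_ones n)) fun i => p i + 1
  rw [hs, Finset.sum_add_distrib] at h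
  simp only [Finset.sum_const, Finset.card_univ, Fintype.card_fin, nsmul_eq_mul] at h
  unfold shift
  convert h using 2
  · push_cast
    ring
  · rfl

theorem map_finRange_finCongr {α : Type*} {n n' : ℕ} (h : n' = n) (f : Fin n → α) :
    (List.finRange n').map (fun i => f (finCongr h i)) = List.ofFn f := by
  subst h
  simp [List.ofFn_eq_map]

theorem evalOn_opsB (m : PartitionedSum 𝒜) (n : ℕ) (w : List A) :
    evalOn (m.opsB (n + 1)) w = evalOn (m.map (ones n)) w :=
  evalOn_domDomCongr _ _ _

/-- The operations `m(1|⋯|1)` form an `A∞` structure on `A[1]`. -/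
theorem isAInfinity_opsB [DirectSum.Decomposition 𝒜] (m : PartitionedSum 𝒜)
    (hdeg : ∀ n, m.superDegree (ones n) ≡ (ones n).d + (ones n).dBar + 1 [ZMOD 2])
    (hm : MasterIdentity m.partB) : IsAInfinity (shift 𝒜) m.opsB where
  degree n hn := by
    obtain ⟨N, rfl⟩ := Nat.exists_eq_add_of_le' hn
    refine ⟨_, ?_, isHomogeneousOfDegree_opsB m N⟩
    have := Int.odd_iff.mp (odd_of_modEq_d_add_dBar N (hdeg N))
    rw [Int.ModEq]
    push_cast
    omega
  relation n hn p a ha := by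
    obtain ⟨N, rfl⟩ := Nat.exists_eq_add_of_le' hn
    let c := finCongr (args_ones N)
    have ha' : ∀ i, a (c i) ∈ 𝒜 (p (c i) + 1) := fun i => ha _
    have h0 := sum_comp_ones m hm N (fun i => p (c i) + 1) (fun i => a (c i)) ha'
    have hLa := map_finRange_finCongr (args_ones N) a
    have hLp := map_finRange_finCongr (args_ones N) p
    have hlen : (List.finRange (ones N).args).length = N + 1 := by
      rw [List.length_finRange, args_ones]
    -- The master identity is multiplied by the tilde sign of the entire word, which depends on
    -- neither `r` nor `s`.
    rw [← smul_zero (tildeExponent ((List.finRange _).map fun i => p (c i) + 1)).negOnePow, ← h0,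
      Finset.smul_sum]
    refine Finset.sum_congr rfl fun s hs => ?_
    obtain ⟨hs1, hs2⟩ := Finset.mem_Icc.mp hs
    obtain ⟨S, rfl⟩ := Nat.exists_eq_add_of_le' hs1
    rw [comp_ones (by omega), Finset.smul_sum]
    refine Finset.sum_congr rfl fun r hr => ?_
    have hr' := Nat.lt_succ_iff.mp (Finset.mem_range.mp hr)
    have hu : ((List.finRange (ones N).args).take r).length = r := by
      rw [List.length_take]; omega
    have hv : (((List.finRange (ones N).args).drop r).take (S + 1)).length = S + 1 := by
      rw [List.length_take, List.length_drop]; omega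
    have hw : ((List.finRange (ones N).args).drop (r + (S + 1))).length = N + 1 - (S + 1) - r := by
      rw [List.length_drop]; omega
    -- The super degrees are `p + 1`; subtracting `r` restores the degrees in the shifted space.
    have hsum : ((((List.finRange (ones N).args).take r).map fun i => p (c i) + 1).sum : ℤ) - r =
        ∑ i with i.val < r, p i := by
      rw [← List.sum_take_ofFn, ← hLp, ← List.map_take, List.sum_map_add, List.map_const',
        List.sum_replicate, hu, nsmul_eq_mul, mul_one, add_sub_cancel_right]
    have happ : (List.finRange (ones N).args).take r ++
        ((List.finRange (ones N).args).drop r).take (S + 1) ++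
        (List.finRange (ones N).args).drop (r + (S + 1)) = List.finRange (ones N).args := by
      rw [List.append_assoc, ← List.drop_drop, List.take_append_drop, List.take_append_drop]
    have key := smul_evalOn_tilde_tilde (m.map (ones (N + 1 - (S + 1)))) (m.map (ones S))
      (odd_of_modEq_d_add_dBar S (hdeg S)) (odd_totalDegree m S (hdeg S)) (m.isHomogeneous (ones S))
      ha' _ _ ((List.finRange (ones N).args).drop (r + (S + 1))) (hv.trans (args_ones S).symm)
      (by rw [hu, hw, args_ones]; omega)
    rw [happ, hu, hv, hw, hsum] at key
    rw [evalOn_opsB, evalOn_opsB, ← hLa, ← List.map_take, ← List.map_drop, ← List.map_take,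
      ← List.map_drop]
    refine Eq.trans ?_ (congrArg _ key.symm)
    rw [smul_smul, ← mul_assoc, Int.units_mul_self, one_mul]

end OpsB

/-! ### Signs of words -/

section WordSign

variable {ι : Type*} [LinearOrder ι]

/-- The sign contributed by the letter `u` in front of the letter `v` to the antisymmetric Koszul
sign of a word: it is trivial unless the letters form an inversion. -/
def inversionSign (p : ι → ℤ) (u v : ι) : ℤˣ :=
  if v < u then -(p u * p v).negOnePow else 1

/-- The antisymmetric Koszul sign of the rearrangement of a word into increasing order. -/
def wordSign (p : ι → ℤ) : List ι → ℤˣ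
  | [] => 1
  | u :: w => (w.map (inversionSign p u)).prod * wordSign p w

/-- The product of the inversion signs of the letters of `v` and `w`. -/
def blockSign (p : ι → ℤ) (v w : List ι) : ℤˣ :=
  (v.map fun u => (w.map (inversionSign p u)).prod).prod

theorem blockSign_cons_left (p : ι → ℤ) (u : ι) (v w : List ι) :
    blockSign p (u :: v) w = (w.map (inversionSign p u)).prod * blockSign p v w := by
  simp [blockSign]

theorem blockSign_append_left (p : ι → ℤ) (u v w : List ι) :
    blockSign p (u ++ v) w = blockSign p u w * blockSign p v w := by
  simp [blockSign]

theorem blockSign_append_right (p : ι → ℤ) (u v w : List ι) :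
    blockSign p u (v ++ w) = blockSign p u v * blockSign p u w := by
  simp [blockSign, List.prod_map_mul]

/-- Inversions between two blocks depend only on the letters each block contains. -/
theorem blockSign_perm (p : ι → ℤ) {v v' w w' : List ι} (hv : v.Perm v') (hw : w.Perm w') :
    blockSign p v w = blockSign p v' w' := by
  have : (fun u => (w.map (inversionSign p u)).prod) =
      fun u => (w'.map (inversionSign p u)).prod :=
    funext fun u => (hw.map _).prod_eq
  rw [blockSign, this]
  exact (hv.map _).prod_eq

/-- Inversions lie inside `v`, inside `w`, or between the two. -/
theorem wordSign_append (p : ι → ℤ) (v w : List ι) :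
    wordSign p (v ++ w) = wordSign p v * wordSign p w * blockSign p v w := by
  induction v with
  | nil => simp [wordSign, blockSign]
  | cons u v ih =>
    simp only [List.cons_append, wordSign, ih, blockSign_cons_left, List.map_append,
      List.prod_append]
    ac_rfl

theorem prod_inversionSign_of_forall_le (p : ι → ℤ) (u : ι) (w : List ι) (h : ∀ v ∈ w, u ≤ v) :
    (w.map (inversionSign p u)).prod = 1 := by
  refine List.prod_eq_one fun z hz => ?_
  obtain ⟨v, hv, rfl⟩ := List.mem_map.mp hz
  exact if_neg (h v hv).not_gt

theorem wordSign_of_pairwise (p : ι → ℤ) {w : List ι} (h : w.Pairwise (· < ·)) :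
    wordSign p w = 1 := by
  induction w with
  | nil => rfl
  | cons u w ih =>
    rw [List.pairwise_cons] at h
    rw [wordSign, ih h.2, prod_inversionSign_of_forall_le p u w fun v hv => (h.1 v hv).le, one_mul]

/-- Exactly one of the two orders of distinct letters is an inversion. -/
theorem inversionSign_swap (p : ι → ℤ) {u v : ι} (h : u ≠ v) :
    inversionSign p u v = inversionSign p v u * (1 + p u * p v).negOnePow := by
  rw [inversionSign, inversionSign, Int.negOnePow_add, Int.negOnePow_one, mul_comm (p v)]
  rcases lt_or_gt_of_ne h with h | h
  · simp [h, h.not_gt, Int.units_mul_self]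
  · simp [h, h.not_gt]

theorem prod_inversionSign_swap (p : ι → ℤ) (u : ι) : ∀ w : List ι, u ∉ w →
    (w.map (inversionSign p u)).prod =
      blockSign p w [u] * ((w.length : ℤ) + p u * (w.map p).sum).negOnePow
  | [], _ => by simp [blockSign]
  | v :: w, h => by
    rw [List.mem_cons, not_or] at h
    rw [List.map_cons, List.prod_cons, prod_inversionSign_swap p u w h.2, inversionSign_swap p h.1,
      blockSign_cons_left]
    simp only [List.length_cons, List.map_cons, List.sum_cons, Nat.cast_add, Nat.cast_one, mul_add,
      Int.negOnePow_add, List.map_nil, List.prod_cons, List.prod_nil, mul_one]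
    ac_rfl

theorem blockSign_swap (p : ι → ℤ) (w : List ι) : ∀ v : List ι, v.Disjoint w →
    blockSign p v w = blockSign p w v *
      ((v.length : ℤ) * w.length + (v.map p).sum * (w.map p).sum).negOnePow
  | [], _ => by simp [blockSign]
  | u :: v, h => by
    rw [List.disjoint_cons_left] at h
    rw [blockSign_cons_left, blockSign_swap p w v h.2, prod_inversionSign_swap p u w h.1,
      show u :: v = [u] ++ v from rfl, blockSign_append_right]
    simp only [List.length_append, List.map_append, List.sum_append, Nat.cast_add,
      List.length_singleton, Nat.cast_one, add_mul, one_mul, List.map_cons, List.map_nil,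
      List.sum_singleton, Int.negOnePow_add]
    ac_rfl

/-- Interchanging two adjacent blocks of a word. -/
theorem wordSign_swap_blocks (p : ι → ℤ) (u v w : List ι) (h : u.Disjoint v) :
    wordSign p (u ++ v ++ w) = wordSign p (v ++ u ++ w) *
      ((u.length : ℤ) * v.length + (u.map p).sum * (v.map p).sum).negOnePow := by
  simp only [wordSign_append, blockSign_append_left, blockSign_swap p v u h]
  ac_rfl

theorem wordSign_ofFn (p : ι → ℤ) : ∀ {n : ℕ} (f : Fin n → ι),
    wordSign p (List.ofFn f) = ∏ i, ∏ j ∈ Finset.Ioi i, inversionSign p (f i) (f j)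
  | 0, f => by simp [wordSign]
  | n + 1, f => by
    rw [List.ofFn_succ, wordSign, wordSign_ofFn p, Fin.prod_univ_succ, Fin.prod_Ioi_zero,
      List.map_ofFn, List.prod_ofFn]
    simp only [Fin.prod_Ioi_succ, Function.comp_def]

end WordSign

/-! ### Signs of permutations as signs of words -/

section AntisymmSign

theorem prod_Ioi_eq_prod_filter {n : ℕ} (F : Fin n → Fin n → ℤˣ) :
    ∏ i, ∏ j ∈ Finset.Ioi i, F i j = ∏ x : Fin n × Fin n with x.1 < x.2, F x.1 x.2 := by
  rw [Finset.prod_filter, Fintype.prod_prod_type]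
  refine Finset.prod_congr rfl fun i _ => ?_
  rw [← Finset.prod_filter, Finset.filter_lt_eq_Ioi]

theorem antisymmSign_eq_prod {n : ℕ} (σ : Equiv.Perm (Fin n)) (p : Fin n → ℤ) :
    antisymmSign σ p =
      ∏ x : Fin n × Fin n with x.1 < x.2, inversionSign p (σ x.1) (σ x.2) := by
  rw [antisymmSign, σ.sign_eq_prod_prod_Ioi, prod_Ioi_eq_prod_filter, ← Finset.filter_filter,
    Finset.prod_filter (fun x : Fin n × Fin n => σ x.2 < σ x.1), ← Finset.prod_mul_distrib]
  refine Finset.prod_congr rfl fun x hx => ?_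
  have hne : σ x.1 ≠ σ x.2 := σ.injective.ne (Finset.mem_filter.mp hx).2.ne
  rw [inversionSign]
  rcases lt_or_gt_of_ne hne with h | h
  · simp [h, h.not_gt]
  · simp [h, h.not_gt]

/-- A strictly increasing relabelling preserves inversions. Signs can thus be computed for subwords
and for words with an added letter. -/
theorem antisymmSign_eq_wordSign {ι : Type*} [LinearOrder ι] {n : ℕ} (σ : Equiv.Perm (Fin n))
    (p : ι → ℤ) {f : Fin n → ι} (hf : StrictMono f) :
    antisymmSign σ (fun i => p (f i)) = wordSign p (List.ofFn fun i => f (σ i)) := by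
  rw [antisymmSign_eq_prod, wordSign_ofFn, prod_Ioi_eq_prod_filter]
  simp only [inversionSign, hf.lt_iff_lt]

/-- For symmetric `g` this is a product over unordered pairs, which `σ` permutes. -/
theorem prod_lt_comp_perm {n : ℕ} (σ : Equiv.Perm (Fin n)) (g : Fin n → Fin n → ℤˣ)
    (hg : ∀ i j, g i j = g j i) :
    ∏ x : Fin n × Fin n with x.1 < x.2, g (σ x.1) (σ x.2) =
      ∏ x : Fin n × Fin n with x.1 < x.2, g x.1 x.2 := by
  refine Finset.prod_nbij'
    (fun x => if σ x.1 < σ x.2 then (σ x.1, σ x.2) else (σ x.2, σ x.1))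
    (fun x => if σ.symm x.1 < σ.symm x.2 then (σ.symm x.1, σ.symm x.2)
      else (σ.symm x.2, σ.symm x.1)) ?_ ?_ ?_ ?_ ?_
  · rintro ⟨i, j⟩ h
    have hij : i < j := (Finset.mem_filter.mp h).2
    have := σ.injective.ne hij.ne
    simp only [Finset.mem_filter, Finset.mem_univ, true_and]
    split_ifs with h'
    · exact h'
    · exact lt_of_le_of_ne (not_lt.mp h') this.symm
  · rintro ⟨i, j⟩ h
    have hij : i < j := (Finset.mem_filter.mp h).2
    have := σ.symm.injective.ne hij.ne
    simp only [Finset.mem_filter, Finset.mem_univ, true_and]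
    split_ifs with h'
    · exact h'
    · exact lt_of_le_of_ne (not_lt.mp h') this.symm
  · rintro ⟨i, j⟩ h
    have hij : i < j := (Finset.mem_filter.mp h).2
    by_cases h' : σ i < σ j <;> simp [h', hij, hij.not_gt]
  · rintro ⟨i, j⟩ h
    have hij : i < j := (Finset.mem_filter.mp h).2
    by_cases h' : σ.symm i < σ.symm j <;> simp [h', hij, hij.not_gt]
  · rintro ⟨i, j⟩ h
    dsimp only
    split_ifs
    · rfl
    · exact hg _ _

theorem antisymmSign_mul {n : ℕ} (σ τ : Equiv.Perm (Fin n)) (p : Fin n → ℤ) :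
    antisymmSign (σ * τ) p = antisymmSign σ p * antisymmSign τ fun i => p (σ i) := by
  -- Sorting the pair before applying `σ` makes the factor symmetric, so the product for `σ` can be
  -- reindexed by `τ`. The factors of `σ * τ` then differ from it exactly at the inversions of `τ`.
  have key := prod_lt_comp_perm τ (fun i j => if i < j then inversionSign p (σ i) (σ j)
    else inversionSign p (σ j) (σ i)) fun i j => by
      rcases lt_trichotomy i j with h | rfl | h
      · simp [h, h.not_gt]
      · rfl
      · simp [h, h.not_gt]
  have hσ : ∏ x : Fin n × Fin n with x.1 < x.2, inversionSign p (σ x.1) (σ x.2) =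
      ∏ x : Fin n × Fin n with x.1 < x.2, if x.1 < x.2 then inversionSign p (σ x.1) (σ x.2)
        else inversionSign p (σ x.2) (σ x.1) :=
    Finset.prod_congr rfl fun x hx => (if_pos (Finset.mem_filter.mp hx).2).symm
  rw [antisymmSign_eq_prod, antisymmSign_eq_prod, antisymmSign_eq_prod, hσ, ← key,
    ← Finset.prod_mul_distrib]
  refine Finset.prod_congr rfl fun x hx => ?_
  have hne : τ x.1 ≠ τ x.2 := τ.injective.ne (Finset.mem_filter.mp hx).2.ne
  rw [Equiv.Perm.mul_apply, Equiv.Perm.mul_apply]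
  rcases lt_or_gt_of_ne hne with h | h
  · rw [if_pos h, inversionSign, inversionSign, if_neg h.not_gt, mul_one]
  · have hinv : inversionSign (fun i => p (σ i)) (τ x.1) (τ x.2) =
        -(p (σ (τ x.1)) * p (σ (τ x.2))).negOnePow := if_pos h
    rw [if_neg h.not_gt, inversionSign_swap p (σ.injective.ne hne), Int.negOnePow_add,
      Int.negOnePow_one, hinv, neg_mul, one_mul]

end AntisymmSign

/-! ### Sums over arrangements -/

section Arrangements

variable {ι : Type*}

/-- The words which are rearrangements of `v`. -/
noncomputable def arrangements (v : List ι) : Finset (List ι) :=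
  open Classical in v.permutations.toFinset

theorem mem_arrangements {v w : List ι} : w ∈ arrangements v ↔ w.Perm v := by
  simp [arrangements]

variable {M : Type*} [AddCommMonoid M]

theorem sum_perm_eq_sum_arrangements {n : ℕ} {f : Fin n → ι} (hf : Function.Injective f)
    (F : List ι → M) :
    ∑ σ : Equiv.Perm (Fin n), F (List.ofFn fun i => f (σ i)) =
      ∑ w ∈ arrangements (List.ofFn f), F w := by
  refine Finset.sum_bij (fun σ _ => List.ofFn fun i => f (σ i)) (fun σ _ => ?_)
    (fun σ _ τ _ h => ?_) (fun w hw => ?_) fun _ _ => rfl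
  · exact mem_arrangements.mpr (σ.ofFn_comp_perm f)
  · exact Equiv.ext fun i => hf (congrFun (List.ofFn_injective h) i)
  · rw [mem_arrangements] at hw
    have hlen : w.length = n := by simpa using hw.length_eq
    subst hlen
    have hnd : w.Nodup := hw.nodup_iff.mpr (List.nodup_ofFn.mpr hf)
    have hex : ∀ i : Fin w.length, ∃ j, f j = w[i] := fun i => by
      simpa [List.mem_ofFn] using hw.subset (List.getElem_mem i.2)
    choose g hg using hex
    have hgi : Function.Injective g := fun i j h => by
      have : w[i] = w[j] := by rw [← hg, ← hg, h]
      exact Fin.ext (hnd.getElem_inj_iff.mp this)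
    refine ⟨Equiv.ofBijective g (Finite.injective_iff_bijective.mp hgi), Finset.mem_univ _, ?_⟩
    simp [hg]

theorem sum_arrangements_map {κ : Type*} {f : ι → κ} (hf : Function.Injective f) (v : List ι)
    (F : List κ → M) :
    ∑ w ∈ arrangements (v.map f), F w = ∑ w ∈ arrangements v, F (w.map f) := by
  symm
  refine Finset.sum_bij (fun w _ => w.map f) (fun w hw => ?_) (fun w _ w' _ h => ?_)
    (fun w hw => ?_) fun _ _ => rfl
  · exact mem_arrangements.mpr ((mem_arrangements.mp hw).map f)
  · exact List.map_injective_iff.mpr hf h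
  · rw [mem_arrangements] at hw
    have : w ∈ Set.range (List.map f) := by
      rw [Set.range_list_map]
      intro x hx
      obtain ⟨y, -, rfl⟩ := List.mem_map.mp (hw.subset hx)
      exact ⟨y, rfl⟩
    obtain ⟨w, rfl⟩ := this
    exact ⟨w, mem_arrangements.mpr ((List.map_perm_map_iff hf).mp hw), rfl⟩

/-- Deleting `x` from an arrangement recovers `w`, and its position recovers `r`; both are
unambiguous because `x` occurs only once. -/
theorem sum_arrangements_cons {x : ι} {v : List ι} (hx : x ∉ v) (F : List ι → M) :
    ∑ w ∈ arrangements (x :: v), F w =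
      ∑ w ∈ arrangements v, ∑ r ∈ Finset.range (v.length + 1), F (w.take r ++ x :: w.drop r) := by
  rw [Finset.sum_sigma']
  symm
  refine Finset.sum_bij (fun y _ => y.1.take y.2 ++ x :: y.1.drop y.2) ?_ ?_ ?_ fun _ _ => rfl
  · rintro ⟨w, r⟩ hw
    have hw := mem_arrangements.mp (Finset.mem_sigma.mp hw).1
    refine mem_arrangements.mpr (List.perm_middle.trans ?_)
    rw [List.take_append_drop]
    exact hw.cons x
  · rintro ⟨w, r⟩ hw ⟨w', r'⟩ hw' h
    simp only [Finset.mem_sigma, mem_arrangements, Finset.mem_range] at hw hw'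
    have h1 : x ∉ w := fun h => hx (hw.1.subset h)
    have hl : w.length = v.length := hw.1.length_eq
    have hl' : w'.length = v.length := hw'.1.length_eq
    have hr1 : r < v.length + 1 := hw.2
    have hr2 : r' < v.length + 1 := hw'.2
    obtain ⟨ht, -, hd⟩ := (List.append_cons_inj_of_notMem
      (fun h => hx (hw'.1.subset (List.mem_of_mem_take h)))
      (fun h => hx (hw'.1.subset (List.mem_of_mem_drop h))) |>.mp h.symm)
    have hww : w = w' := by
      rw [← List.take_append_drop r w, ← List.take_append_drop r' w', ht, hd]
    have hr := congrArg List.length ht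
    simp only [List.length_take] at hr
    obtain rfl : r = r' := by omega
    rw [hww]
  · intro w hw
    rw [mem_arrangements] at hw
    obtain ⟨s, t, rfl⟩ := List.append_of_mem (hw.symm.subset List.mem_cons_self)
    have hst : (s ++ t).Perm v := (List.perm_middle.symm.trans hw).cons_inv
    refine ⟨⟨s ++ t, s.length⟩, ?_, by simp⟩
    have := hst.length_eq
    rw [List.length_append] at this
    simp only [Finset.mem_sigma, mem_arrangements, Finset.mem_range]
    exact ⟨hst, by omega⟩

end Arrangements

/-! ### Graded antisymmetrization on words -/

section Antisymm

variable {k : Type*} [Field k] {A : Type*} [AddCommGroup A] [Module k A]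
  {𝒜 : ℤ → Submodule k A} [DirectSum.Decomposition 𝒜]

theorem isHomogeneousOfDegree_gradedAntisymm {n : ℕ}
    {x : MultilinearMap k (fun _ : Fin n => A) A} {s : ℤ} (hx : IsHomogeneousOfDegree 𝒜 x s) :
    IsHomogeneousOfDegree 𝒜 (gradedAntisymm 𝒜 x) s := by
  intro p a ha
  rw [gradedAntisymm_apply_of_mem 𝒜 x p a ha]
  refine Submodule.sum_mem _ fun σ _ => ?_
  rw [Units.smul_def]
  refine zsmul_mem ?_ _
  rw [← Equiv.sum_comp σ p]
  exact hx _ _ fun i => ha (σ i)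

/-- Left multiplication by `σ` reindexes the sum, and the signs match by the cocycle rule
`antisymmSign_mul`. -/
theorem gradedAntisymm_perm {n : ℕ} (x : MultilinearMap k (fun _ : Fin n => A) A) (p : Fin n → ℤ)
    (a : Fin n → A) (ha : ∀ i, a i ∈ 𝒜 (p i)) (σ : Equiv.Perm (Fin n)) :
    gradedAntisymm 𝒜 x a = antisymmSign σ p • gradedAntisymm 𝒜 x fun i => a (σ i) := by
  rw [gradedAntisymm_apply_of_mem 𝒜 x p a ha,
    gradedAntisymm_apply_of_mem 𝒜 x (fun i => p (σ i)) _ fun i => ha (σ i), Finset.smul_sum,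
    ← Equiv.sum_comp (Equiv.mulLeft σ)]
  refine Finset.sum_congr rfl fun τ _ => ?_
  rw [smul_smul, Equiv.coe_mulLeft, antisymmSign_mul]
  rfl

variable {ι : Type*} [LinearOrder ι]

theorem evalOn_gradedAntisymm {n : ℕ} (x : MultilinearMap k (fun _ : Fin n => A) A) {p : ι → ℤ}
    {a : ι → A} (ha : ∀ i, a i ∈ 𝒜 (p i)) {v : List ι} (hv : v.Pairwise (· < ·))
    (hn : v.length = n) :
    evalOn (gradedAntisymm 𝒜 x) (v.map a) =
      ∑ w ∈ arrangements v, wordSign p w • evalOn x (w.map a) := by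
  subst hn
  have hf : StrictMono v.get := (List.pairwise_iff_get.mp hv · · ·)
  have hfv : List.ofFn v.get = v := List.ofFn_get v
  have hval : evalOn (gradedAntisymm 𝒜 x) (v.map a) =
      gradedAntisymm 𝒜 x fun i => a (v.get i) := by
    rw [← evalOn_ofFn]
    congr 1
    conv_lhs => rw [← hfv, List.map_ofFn]
    rfl
  have hsum := sum_perm_eq_sum_arrangements hf.injective
    fun w => wordSign p w • evalOn x (w.map a)
  rw [hfv] at hsum
  rw [hval, gradedAntisymm_apply_of_mem 𝒜 x (fun i => p (v.get i)) _ fun i => ha _, ← hsum]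
  refine Finset.sum_congr rfl fun σ _ => ?_
  rw [antisymmSign_eq_wordSign σ p hf, List.map_ofFn, ← evalOn_ofFn]
  rfl

/-- The function on `WithBot ι` with value `b` at the bottom element. -/
def extendBot {β : Type*} (b : β) (f : ι → β) : WithBot ι → β :=
  fun i => WithBot.recBotCoe b f i

omit [LinearOrder ι] in
theorem map_coe_extendBot {β : Type*} (b : β) (f : ι → β) (w : List ι) :
    (w.map ((↑) : ι → WithBot ι)).map (extendBot b f) = w.map f := by
  rw [List.map_map]
  rfl

theorem map_coe_inversionSign_extendBot (d : ℤ) (p : ι → ℤ) (u : ι) (w : List ι) :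
    (w.map ((↑) : ι → WithBot ι)).map (inversionSign (extendBot d p) u) =
      w.map (inversionSign p u) := by
  rw [List.map_map]
  refine List.map_congr_left fun v _ => ?_
  simp only [inversionSign, Function.comp_apply, WithBot.coe_lt_coe]
  rfl

theorem wordSign_map_coe_extendBot (d : ℤ) (p : ι → ℤ) (w : List ι) :
    wordSign (extendBot d p) (w.map (↑)) = wordSign p w := by
  induction w with
  | nil => rfl
  | cons u w ih => rw [List.map_cons, wordSign, ih, map_coe_inversionSign_extendBot, wordSign]

/-- In front, `⊥` forms no inversions; the extra sign comes from interchanging it with the block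
`v`. -/
theorem wordSign_insert_bot (d : ℤ) (p : ι → ℤ) (v w : List ι) :
    wordSign (extendBot d p) (v.map (↑) ++ ⊥ :: w.map (↑)) =
      wordSign p (v ++ w) * ((v.length : ℤ) + d * (v.map p).sum).negOnePow := by
  have h := wordSign_swap_blocks (extendBot d p) (v.map (↑)) [⊥] (w.map (↑)) (by simp)
  rw [List.append_assoc, List.singleton_append] at h
  rw [h, List.append_assoc, List.singleton_append, wordSign,
    prod_inversionSign_of_forall_le _ _ _ fun _ _ => bot_le, one_mul, ← List.map_append,
    wordSign_map_coe_extendBot, map_coe_extendBot]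
  simp [extendBot, mul_comm]

/-- The antisymmetrization of `x` at a word whose first letter is distinguished. -/
theorem evalOn_gradedAntisymm_cons {n : ℕ} (x : MultilinearMap k (fun _ : Fin n => A) A)
    {p : ι → ℤ} {a : ι → A} (ha : ∀ i, a i ∈ 𝒜 (p i)) {v : List ι} (hv : v.Pairwise (· < ·))
    (hn : v.length + 1 = n) {d : ℤ} {b : A} (hb : b ∈ 𝒜 d) :
    evalOn (gradedAntisymm 𝒜 x) (b :: v.map a) =
      ∑ w ∈ arrangements v, ∑ r ∈ Finset.range (v.length + 1),
        (wordSign p w * ((r : ℤ) + d * ((w.take r).map p).sum).negOnePow) •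
          evalOn x ((w.take r).map a ++ b :: (w.drop r).map a) := by
  have ha' : ∀ i, extendBot b a i ∈ 𝒜 (extendBot d p i) := fun i => by
    induction i with
    | bot => exact hb
    | coe i => exact ha i
  -- With `b` as the letter `⊥`, the word remains increasing and `evalOn_gradedAntisymm` applies.
  have hv' : ((⊥ : WithBot ι) :: v.map (↑)).Pairwise (· < ·) := by
    rw [List.pairwise_cons]
    refine ⟨fun z hz => ?_, hv.map _ fun _ _ => WithBot.coe_lt_coe.mpr⟩
    obtain ⟨i, -, rfl⟩ := List.mem_map.mp hz
    exact WithBot.bot_lt_coe i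
  have h := evalOn_gradedAntisymm x ha' hv' (by simpa using hn)
  rw [List.map_cons, map_coe_extendBot, sum_arrangements_cons (by simp),
    sum_arrangements_map WithBot.coe_injective] at h
  refine h.trans (Finset.sum_congr rfl fun w hw => ?_)
  rw [List.length_map]
  refine Finset.sum_congr rfl fun r hr => ?_
  have hl := (mem_arrangements.mp hw).length_eq
  have hr' := Finset.mem_range.mp hr
  rw [← List.map_take, ← List.map_drop, wordSign_insert_bot, List.take_append_drop,
    List.map_append, List.map_cons, map_coe_extendBot, map_coe_extendBot, List.length_take,
    min_eq_left (by omega)]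
  rfl

/-- The composition of two antisymmetrizations at a word `v w`. -/
theorem evalOn_gradedAntisymm_gradedAntisymm {s n : ℕ}
    (x : MultilinearMap k (fun _ : Fin n => A) A) (y : MultilinearMap k (fun _ : Fin s => A) A)
    {e : ℤ} (hy : IsHomogeneousOfDegree 𝒜 y e) {p : ι → ℤ} {a : ι → A}
    (ha : ∀ i, a i ∈ 𝒜 (p i)) {v w : List ι} (hv : v.Pairwise (· < ·)) (hw : w.Pairwise (· < ·))
    (hs : v.length = s) (hn : w.length + 1 = n) :
    wordSign p (v ++ w) •
        evalOn (gradedAntisymm 𝒜 x) (evalOn (gradedAntisymm 𝒜 y) (v.map a) :: w.map a) =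
      ∑ v' ∈ arrangements v, ∑ w' ∈ arrangements w, ∑ r ∈ Finset.range (w.length + 1),
        (wordSign p (v' ++ w') *
          ((r : ℤ) + ((v'.map p).sum + e) * ((w'.take r).map p).sum).negOnePow) •
          evalOn x ((w'.take r).map a ++ evalOn y (v'.map a) :: (w'.drop r).map a) := by
  have hmem : evalOn (gradedAntisymm 𝒜 y) (v.map a) ∈ 𝒜 ((v.map p).sum + e) :=
    evalOn_mem (isHomogeneousOfDegree_gradedAntisymm hy) (forall₂_map_mem ha v) (by simpa using hs)
  rw [evalOn_gradedAntisymm_cons x ha hw hn hmem, evalOn_gradedAntisymm y ha hv hs,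
    Finset.smul_sum, Finset.sum_comm]
  refine Finset.sum_congr rfl fun w' hw' => ?_
  have hw' := mem_arrangements.mp hw'
  rw [Finset.smul_sum, Finset.sum_comm]
  refine Finset.sum_congr rfl fun r hr => ?_
  have hr' := Finset.mem_range.mp hr
  have hlen : ((w'.take r).map a).length < n := by
    rw [List.length_map, List.length_take]
    omega
  rw [evalOn_sum _ _ _ hlen, Finset.smul_sum, Finset.smul_sum]
  refine Finset.sum_congr rfl fun v' hv' => ?_
  have hv' := mem_arrangements.mp hv'
  -- As `v` and `w` are increasing, the sign of `v ++ w` is just their block sign. It is unchanged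
  -- by rearranging the blocks, and completes the signs of `v'` and `w'` to that of `v' ++ w'`.
  rw [evalOn_units_smul _ _ _ hlen, smul_smul, smul_smul, (hv'.map p).sum_eq, wordSign_append,
    wordSign_append, wordSign_of_pairwise p hv, wordSign_of_pairwise p hw,
    blockSign_perm p hv' hw']
  congr 1
  simp only [one_mul]
  ac_rfl

end Antisymm

/-! ### Unshuffles and the `L∞` relations -/

section Unshuffles

variable {ι : Type*} {M : Type*} [AddCommMonoid M]

theorem exists_pairwise_perm [LinearOrder ι] {v : List ι} (hv : v.Nodup) :
    ∃ w : List ι, w.Pairwise (· < ·) ∧ w.Perm v := by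
  have hp := List.perm_insertionSort (· ≤ ·) v
  refine ⟨v.insertionSort (· ≤ ·), ?_, hp⟩
  exact (List.pairwise_insertionSort (· ≤ ·) v).imp₂ (fun _ _ h h' => lt_of_le_of_ne h h')
    (hp.nodup_iff.mpr hv)

theorem eq_of_pairwise_perm [LinearOrder ι] {v w : List ι} (hv : v.Pairwise (· < ·))
    (hw : w.Pairwise (· < ·)) (h : v.Perm w) : v = w :=
  h.eq_of_pairwise (fun _ _ _ _ h1 h2 => absurd h1 h2.not_gt) hv hw

/-- Every word arises uniquely from an unshuffle by rearranging its two parts. -/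
theorem sum_unshuffles_arrangements [LinearOrder ι] {u : List ι} (hu : u.Nodup) {s : ℕ}
    (hs : s ≤ u.length) (F : List ι → List ι → M) :
    ∑ w ∈ arrangements u with (w.take s).Pairwise (· < ·) ∧ (w.drop s).Pairwise (· < ·),
      ∑ v ∈ arrangements (w.take s), ∑ v' ∈ arrangements (w.drop s), F v v' =
    ∑ w ∈ arrangements u, F (w.take s) (w.drop s) := by
  simp only [← Finset.sum_product']
  rw [Finset.sum_sigma']
  refine Finset.sum_bij (fun y _ => y.2.1 ++ y.2.2) ?_ ?_ ?_ ?_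
  · rintro ⟨w, v, v'⟩ h
    simp only [Finset.mem_sigma, Finset.mem_filter, Finset.mem_product, mem_arrangements] at h ⊢
    refine (h.2.1.append h.2.2).trans ?_
    rw [List.take_append_drop]
    exact h.1.1
  · rintro ⟨w, v, v'⟩ h ⟨w₁, v₁, v₁'⟩ h₁ heq
    simp only [Finset.mem_sigma, Finset.mem_filter, Finset.mem_product, mem_arrangements] at h h₁
    have hl : v.length = s := by
      rw [h.2.1.length_eq, List.length_take, h.1.1.length_eq, min_eq_left hs]
    have hl₁ : v₁.length = s := by
      rw [h₁.2.1.length_eq, List.length_take, h₁.1.1.length_eq, min_eq_left hs]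
    obtain ⟨rfl, rfl⟩ := List.append_inj heq (hl.trans hl₁.symm)
    have h1 := eq_of_pairwise_perm h.1.2.1 h₁.1.2.1 (h.2.1.symm.trans h₁.2.1)
    have h2 := eq_of_pairwise_perm h.1.2.2 h₁.1.2.2 (h.2.2.symm.trans h₁.2.2)
    obtain rfl : w = w₁ := by
      rw [← List.take_append_drop s w, h1, h2, List.take_append_drop]
    rfl
  · intro w hw
    rw [mem_arrangements] at hw
    have hnd := hw.nodup_iff.mpr hu
    -- Sorting both parts of `w` yields the unshuffle from which it arises.
    obtain ⟨v, hv, hvp⟩ := exists_pairwise_perm (hnd.sublist (List.take_sublist s w))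
    obtain ⟨v', hv', hvp'⟩ := exists_pairwise_perm (hnd.sublist (List.drop_sublist s w))
    have hl : v.length = s := by
      rw [hvp.length_eq, List.length_take, hw.length_eq, min_eq_left hs]
    refine ⟨⟨v ++ v', w.take s, w.drop s⟩, ?_, List.take_append_drop s w⟩
    simp only [Finset.mem_sigma, Finset.mem_filter, Finset.mem_product, mem_arrangements,
      List.take_left' hl, List.drop_left' hl]
    refine ⟨⟨(hvp.append hvp').trans ?_, hv, hv'⟩, hvp.symm, hvp'.symm⟩
    rwa [List.take_append_drop]
  · rintro ⟨w, v, v'⟩ h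
    simp only [Finset.mem_sigma, Finset.mem_filter, Finset.mem_product, mem_arrangements] at h
    have hl : v.length = s := by
      rw [h.2.1.length_eq, List.length_take, h.1.1.length_eq, min_eq_left hs]
    simp only [List.take_left' hl, List.drop_left' hl]

/-- Interchanging the first two blocks, of lengths `s` and `r`, of all arrangements. -/
theorem sum_arrangements_swap_blocks {u : List ι} {s r : ℕ} (h : r + s ≤ u.length)
    (F : List ι → List ι → List ι → M) :
    ∑ w ∈ arrangements u, F (w.take s) ((w.drop s).take r) ((w.drop s).drop r) =
      ∑ w ∈ arrangements u, F ((w.drop r).take s) (w.take r) (w.drop (r + s)) := by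
  have hperm : ∀ (w : List ι) (s r : ℕ),
      ((w.drop s).take r ++ w.take s ++ w.drop (s + r)).Perm w := fun w s r => by
    rw [← List.drop_drop]
    refine (List.perm_append_comm.append_right _).trans ?_
    rw [List.append_assoc, List.take_append_drop, List.take_append_drop]
  have hinv : ∀ (w : List ι) (s r : ℕ), w.length = u.length → r + s ≤ u.length →
      ((w.drop s).take r ++ w.take s ++ w.drop (s + r)).take r = (w.drop s).take r ∧
      (((w.drop s).take r ++ w.take s ++ w.drop (s + r)).drop r).take s = w.take s ∧
      ((w.drop s).take r ++ w.take s ++ w.drop (s + r)).drop (r + s) = w.drop (s + r) :=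
    fun w s r hw h => by
      have h1 : ((w.drop s).take r).length = r := by
        rw [List.length_take, List.length_drop]; omega
      have h2 : (w.take s).length = s := by rw [List.length_take]; omega
      refine ⟨?_, ?_, List.drop_left' (by rw [List.length_append, h1, h2])⟩
      · rw [List.append_assoc, List.take_left' h1]
      · rw [List.append_assoc, List.drop_left' h1, List.take_left' h2]
  refine Finset.sum_nbij' (fun w => (w.drop s).take r ++ w.take s ++ w.drop (s + r))
    (fun w => (w.drop r).take s ++ w.take r ++ w.drop (r + s)) ?_ ?_ ?_ ?_ ?_
  · exact fun w hw => mem_arrangements.mpr ((hperm w s r).trans (mem_arrangements.mp hw))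
  · exact fun w hw => mem_arrangements.mpr ((hperm w r s).trans (mem_arrangements.mp hw))
  · intro w hw
    obtain ⟨h1, h2, h3⟩ := hinv w s r (mem_arrangements.mp hw).length_eq h
    rw [h1, h2, h3, List.append_assoc, ← List.drop_drop, List.take_append_drop,
      List.take_append_drop]
  · intro w hw
    obtain ⟨h1, h2, h3⟩ := hinv w r s (mem_arrangements.mp hw).length_eq (by omega)
    rw [h1, h2, h3, List.append_assoc, ← List.drop_drop, List.take_append_drop,
      List.take_append_drop]
  · intro w hw
    obtain ⟨h1, h2, h3⟩ := hinv w s r (mem_arrangements.mp hw).length_eq h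
    rw [h1, h2, h3, List.drop_drop]

theorem sum_perm_eq_sum_arrangements_finRange {n : ℕ} (F : List (Fin n) → M) :
    ∑ σ : Equiv.Perm (Fin n), F (List.ofFn σ) = ∑ w ∈ arrangements (List.finRange n), F w := by
  have h := sum_perm_eq_sum_arrangements (f := fun i : Fin n => i) Function.injective_id F
  rwa [show List.ofFn (fun i : Fin n => i) = List.finRange n from List.ofFn_id n] at h

theorem isUnshuffle_iff {n : ℕ} (σ : Equiv.Perm (Fin n)) (s : ℕ) :
    ((∀ u v, u < v → v.val < s → σ u < σ v) ∧ (∀ u v, s ≤ u.val → u < v → σ u < σ v)) ↔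
      ((List.ofFn σ).take s).Pairwise (· < ·) ∧ ((List.ofFn σ).drop s).Pairwise (· < ·) := by
  refine and_congr ?_ ?_
  · rw [List.pairwise_iff_getElem]
    simp only [List.length_take, List.length_ofFn, List.getElem_take, List.getElem_ofFn]
    constructor
    · intro h i j hi hj hij
      exact h _ _ (Fin.mk_lt_mk.mpr hij) (by simp only; omega)
    · intro h u v huv hv
      exact h u v (by omega) (by omega) huv
  · rw [List.pairwise_iff_getElem]
    simp only [List.length_drop, List.length_ofFn, List.getElem_drop, List.getElem_ofFn]
    constructor
    · intro h i j hi hj hij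
      exact h _ _ (by simp) (Fin.mk_lt_mk.mpr (by omega))
    · intro h u v hu huv
      have := h (u - s) (v - s) (by omega) (by omega) (by omega)
      simpa only [Nat.add_sub_cancel' hu, Nat.add_sub_cancel' (hu.trans (Fin.le_def.mp huv.le))]
        using this

end Unshuffles

/-! ### From `A∞` to `L∞` -/

section LInfinity

variable {k : Type*} [Field k] {A : Type*} [AddCommGroup A] [Module k A]
  {𝒜 : ℤ → Submodule k A} [DirectSum.Decomposition 𝒜]

/-- The sum over the `(s, n - s)`-unshuffles in the `L∞` relation of the antisymmetrizations is the
antisymmetrization of the corresponding sum in the `A∞` relation. -/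
theorem sum_unshuffles_gradedAntisymm {s n : ℕ} (hs : s ≤ n)
    (x : MultilinearMap k (fun _ : Fin (n - s + 1) => A) A)
    (y : MultilinearMap k (fun _ : Fin s => A) A)
    {e : ℤ} (he : e ≡ s [ZMOD 2]) (hy : IsHomogeneousOfDegree 𝒜 y e) {p : Fin n → ℤ}
    {a : Fin n → A} (ha : ∀ i, a i ∈ 𝒜 (p i)) :
    ∑ σ : Equiv.Perm (Fin n) with
        (∀ u v, u < v → v.val < s → σ u < σ v) ∧ (∀ u v, s ≤ u.val → u < v → σ u < σ v),
      (antisymmSign σ p * ((s : ℤ) * (n - s : ℕ)).negOnePow) •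
        evalOn (gradedAntisymm 𝒜 x)
          (evalOn (gradedAntisymm 𝒜 y) ((List.ofFn fun u => a (σ u)).take s) ::
            (List.ofFn fun u => a (σ u)).drop s) =
    ∑ w ∈ arrangements (List.finRange n), ∑ r ∈ Finset.range (n - s + 1),
      (wordSign p w *
        ((r : ℤ) + s * (n - s - r : ℕ) + s * ((w.take r).map p).sum).negOnePow) •
        evalOn x ((w.take r).map a ++ evalOn y (((w.drop r).take s).map a) ::
          (w.drop (r + s)).map a) := by
  -- The unshuffle condition becomes an indicator, so that the sum over permutations can be read as
  -- a sum over words.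
  have hunsh := sum_perm_eq_sum_arrangements_finRange fun w : List (Fin n) =>
    if (w.take s).Pairwise (· < ·) ∧ (w.drop s).Pairwise (· < ·) then
      ((s : ℤ) * (n - s : ℕ)).negOnePow • (wordSign p (w.take s ++ w.drop s) •
        evalOn (gradedAntisymm 𝒜 x)
          (evalOn (gradedAntisymm 𝒜 y) ((w.take s).map a) :: (w.drop s).map a)) else 0
  rw [← Finset.sum_filter, ← Finset.sum_filter] at hunsh
  refine Eq.trans (Finset.sum_congr (Finset.filter_congr fun σ _ => isUnshuffle_iff σ s)
    fun σ _ => ?_) (hunsh.trans ?_)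
  · have hσ : (List.ofFn fun u => a (σ u)) = (List.ofFn σ).map a := by
      rw [List.map_ofFn]; rfl
    have hsign : antisymmSign σ p = wordSign p (List.ofFn σ) :=
      antisymmSign_eq_wordSign σ p (f := fun i => i) strictMono_id
    rw [smul_smul, List.take_append_drop, List.map_take, List.map_drop, hσ, mul_comm, hsign]
  have hlen : (List.finRange n).length = n := List.length_finRange
  trans ∑ w ∈ arrangements (List.finRange n) with
      (w.take s).Pairwise (· < ·) ∧ (w.drop s).Pairwise (· < ·),
      ∑ v ∈ arrangements (w.take s), ∑ v' ∈ arrangements (w.drop s),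
        ∑ r ∈ Finset.range (n - s + 1), (wordSign p (v ++ v') *
          ((s : ℤ) * (n - s : ℕ) + (r + ((v.map p).sum + e) *
            ((v'.take r).map p).sum)).negOnePow) •
          evalOn x ((v'.take r).map a ++ evalOn y (v.map a) :: (v'.drop r).map a)
  · refine Finset.sum_congr rfl fun w hw => ?_
    obtain ⟨hw, hw1, hw2⟩ := Finset.mem_filter.mp hw
    have hl := (mem_arrangements.mp hw).length_eq
    have hd : (w.drop s).length = n - s := by rw [List.length_drop, hl, hlen]
    rw [evalOn_gradedAntisymm_gradedAntisymm x y hy ha hw1 hw2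
      (by rw [List.length_take, hl, hlen, min_eq_left hs]) (by rw [hd]), hd]
    simp only [Finset.smul_sum, smul_smul, Int.negOnePow_add ((s : ℤ) * _), mul_left_comm]
  rw [sum_unshuffles_arrangements (List.nodup_finRange n) (hs.trans hlen.ge), Finset.sum_comm,
    Finset.sum_comm (s := arrangements _)]
  refine Finset.sum_congr rfl fun r hr => ?_
  have hr' : r + s ≤ n := by have := Finset.mem_range.mp hr; omega
  trans ∑ w ∈ arrangements (List.finRange n),
      (wordSign p (w.take s ++ ((w.drop s).take r ++ (w.drop s).drop r)) *
          ((s : ℤ) * (n - s : ℕ) + (r + (((w.take s).map p).sum + e) *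
            (((w.drop s).take r).map p).sum)).negOnePow) •
          evalOn x (((w.drop s).take r).map a ++ evalOn y ((w.take s).map a) ::
            ((w.drop s).drop r).map a)
  · simp only [List.take_append_drop]
  -- The value of `y` stands behind `r` letters; its arguments are moved there too, so that the word
  -- lists all letters in their order of appearance.
  rw [sum_arrangements_swap_blocks (hr'.trans hlen.ge) fun v u w =>
    (wordSign p (v ++ (u ++ w)) * ((s : ℤ) * (n - s : ℕ) + (r + ((v.map p).sum + e) *
      (u.map p).sum)).negOnePow) • evalOn x (u.map a ++ evalOn y (v.map a) :: w.map a)]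
  refine Finset.sum_congr rfl fun w hw => ?_
  have hw := mem_arrangements.mp hw
  have hl := hw.length_eq.trans hlen
  have hnd := hw.nodup_iff.mpr (List.nodup_finRange n)
  have hw3 : w = w.take r ++ (w.drop r).take s ++ w.drop (r + s) := by
    rw [List.append_assoc, ← List.drop_drop, List.take_append_drop, List.take_append_drop]
  have hdisj : (w.take r).Disjoint ((w.drop r).take s) := by
    rw [hw3] at hnd
    exact (List.nodup_append'.mp (List.nodup_append'.mp hnd).1).2.2
  have hsign := wordSign_swap_blocks p _ _ (w.drop (r + s)) hdisj
  rw [← hw3] at hsign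
  rw [hsign, mul_assoc, ← Int.negOnePow_add, List.append_assoc]
  congr 2
  refine negOnePow_congr ?_
  have h1 : (w.take r).length = r := by rw [List.length_take]; omega
  have h2 : ((w.drop r).take s).length = s := by
    rw [List.length_take, List.length_drop]; omega
  rw [h1, h2]
  -- Since `n - s = r + t`, the sign `r * s` of the block interchange reduces `s * (n - s)` to `s *
  -- t`. The product of the degree sums cancels, and `e ≡ s` leaves twice the witness below.
  obtain ⟨c, hc⟩ := he.symm.dvd
  obtain rfl : e = s + 2 * c := by omega
  have ht : ((n - s : ℕ) : ℤ) = r + (n - s - r : ℕ) := by omega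
  rw [ht]
  exact ⟨c * ((w.take r).map p).sum, by ring⟩

/-- The graded antisymmetrization of an `A∞` structure is an `L∞` structure. -/
theorem IsAInfinity.isLInfinity_gradedAntisymm
    {m : ∀ n : ℕ, MultilinearMap k (fun _ : Fin n => A) A} (hm : IsAInfinity 𝒜 m) :
    IsLInfinity 𝒜 fun n => gradedAntisymm 𝒜 (m n) where
  degree n hn := by
    obtain ⟨s, hs, h⟩ := hm.degree n hn
    exact ⟨s, hs, isHomogeneousOfDegree_gradedAntisymm h⟩
  antisymm n _ p a ha σ := gradedAntisymm_perm (m n) p a ha σ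
  relation n hn p a ha := by
    trans ∑ s ∈ Finset.Icc 1 n, ∑ w ∈ arrangements (List.finRange n),
      ∑ r ∈ Finset.range (n - s + 1), (wordSign p w *
        ((r : ℤ) + s * (n - s - r : ℕ) + s * ((w.take r).map p).sum).negOnePow) •
        evalOn (m (n - s + 1)) ((w.take r).map a ++
          evalOn (m s) (((w.drop r).take s).map a) :: (w.drop (r + s)).map a)
    · refine Finset.sum_congr rfl fun s hs => ?_
      obtain ⟨hs1, hs2⟩ := Finset.mem_Icc.mp hs
      obtain ⟨e, he, hy⟩ := hm.degree s hs1
      exact sum_unshuffles_gradedAntisymm hs2 _ _ he hy ha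
    -- With the word fixed outside, the inner double sum is the `A∞` relation at the permuted
    -- arguments, up to the constant sign of the word.
    rw [Finset.sum_comm, ← sum_perm_eq_sum_arrangements_finRange]
    refine Finset.sum_eq_zero fun σ _ => ?_
    have h := hm.relation n hn (fun i => p (σ i)) (fun i => a (σ i)) fun i => ha _
    rw [← smul_zero (wordSign p (List.ofFn σ)), ← h, Finset.smul_sum]
    refine Finset.sum_congr rfl fun s _ => ?_
    rw [Finset.smul_sum]
    refine Finset.sum_congr rfl fun r _ => ?_
    have hσa : (List.ofFn fun u => a (σ u)) = (List.ofFn σ).map a := by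
      rw [List.map_ofFn]; rfl
    have hσp : (List.ofFn fun u => p (σ u)) = (List.ofFn σ).map p := by
      rw [List.map_ofFn]; rfl
    rw [smul_smul, ← List.sum_take_ofFn, hσa, hσp]
    simp only [List.map_take, List.map_drop]

end LInfinity

end HomotopyGerstenhaber

theorem mainTheorem6 {k : Type*} [Field k] [CharZero k] {A : Type*} [AddCommGroup A] [Module k A]
    (𝒜 : ℤ → Submodule k A) [DirectSum.Decomposition 𝒜]
    (m : HomotopyGerstenhaber.PartitionedSum 𝒜)
    (hm : HomotopyGerstenhaber.IsGInfinity m)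
    (hzero : ∀ π : HomotopyGerstenhaber.OrdPartition, π.HasZeroSlot → m.map π = 0) :
    HomotopyGerstenhaber.MasterIdentity m.partB ∧
      HomotopyGerstenhaber.IsAInfinity (HomotopyGerstenhaber.shift 𝒜) m.opsB ∧
      HomotopyGerstenhaber.IsLInfinity (HomotopyGerstenhaber.shift 𝒜) (fun n =>
        HomotopyGerstenhaber.gradedAntisymm (HomotopyGerstenhaber.shift 𝒜) (m.opsB n)) := by
  have hB := HomotopyGerstenhaber.masterIdentity_partB m hm.master hzero
  have hA := HomotopyGerstenhaber.isAInfinity_opsB m (fun n => hm.superDegree_modEq _) hB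
  exact ⟨hB, hA, hA.isLInfinity_gradedAntisymm⟩
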